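/- **Theorem (dynamic candidates).** Let $0<\sigma<1$. Vehicles $i$ from a countable set have gains $G_i(t)$, $t=0,1,2,\dots$, which are independent reflected Gaussian random walks on $[0,1]$: the $G_i(0)$ are uniform on $[0,1]$ and $G_i(t+1)=f(G_i(t)+X_i(t))$, where the $X_i(t)$ are $\mathcal N(0,\sigma^2)$, all $G_i(0)$ and $X_i(t)$ are mutually independent, and $f(x)=x'$ if $x'<1$, $f(x)=2-x'$ if $x'\ge 1$, with $x'\in[0,2)$, $x'\equiv x \pmod 2$. In each slot $t=1,\dots,T$ there is a (possibly random) candidate set $\mathcal V_t$ of at most two vehicles; the process $(\mathcal V_t)$ is independent of the gains. The MASS algorithm with parameter $\beta$ schedules in each slot with $\mathcal V_t\neq\emptyset$ one vehicle $a_t\in\mathcal V_t$ and observes $G_{a_t}(t)$: if some vehicle in $\mathcal V_t$ has never been scheduled, $a_t$ is such a vehicle; otherwise $a_t$ maximizes $G_i(\tau_i)+\beta\sqrt{t-\tau_i}$ over $i\in\mathcal V_t$, where $\tau_i<t$ is the last slot in which $i$ was scheduled; ties are broken arbitrarily. Its expected average learning regret is $$\bar R=\frac1T\,\mathbb E\sum_{1\le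 t\le T,\ \mathcal V_t\ne\emptyset}\Big[\max_{i\in\mathcal V_t}G_i(t)-G_{a_t}(t)\Big],$$ and the arrival rate of candidates is $\lambda=\frac1T\,\mathbb E\sum_{t=2}^T|\mathcal V_t\setminus\mathcal V_{t-1}|$. Let $\beta=15\,\sigma\log(1/\sigma)$. (1) For every $c>0$ there are $C>0$ and $\sigma_0\in(0,1)$, depending only on $c$, such that for all $\sigma\in(0,\sigma_0)$ and all $T\ge c\,\sigma^{-2}$, $$\bar R\le C\,\sigma^2\log^3(1/\sigma)+2\lambda .$$ (2) For all $c,K>0$ there are $C>0$ and $\sigma_0\in(0,1)$, depending only on $c$ and $K$, such that for all $\sigma\in(0,\sigma_0)$ and all $T\ge c\,\sigma^{-2}$, if $\lambda\le K\sigma^2\log^3(1/\sigma)$ then $$\bar R\le C\,\sigma^2\log^3(1/\sigma).$$ -/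

import Mathlib

open MeasureTheory ProbabilityTheory

universe u

namespace SensorScheduling

/-- Reflection of the real line onto `[0, 1]`: with `y ∈ [0, 2)`, `y ≡ x (mod 2)`,
the value is `y` if `y < 1` and `2 - y` otherwise. -/
noncomputable def reflect (x : ℝ) : ℝ :=
  if 2 * Int.fract (x / 2) < 1 then 2 * Int.fract (x / 2) else 2 - 2 * Int.fract (x / 2)

/-- The gains `G i t` of the vehicles `i = 0, 1, 2, …` at the times `t = 0, 1, 2, …` are
independent stationary Gaussian random walks on `[0, 1]` with reflecting boundaries, driven by
the increments `X i t` of standard deviation `σ`. -/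
structure IsReflectedWalk {Ω : Type u} [MeasurableSpace Ω] (μ : Measure Ω) (σ : ℝ)
    (G X : ℕ → ℕ → Ω → ℝ) : Prop where
  measurable_init : ∀ i, Measurable (G i 0)
  measurable_incr : ∀ i t, Measurable (X i t)
  /-- the initial gains are uniform on `[0, 1]` -/
  init_law : ∀ i, μ.map (G i 0) = volume.restrict (Set.Icc (0 : ℝ) 1)
  /-- the increments are centred Gaussian with variance `σ ^ 2` -/
  incr_law : ∀ i t, μ.map (X i t) = gaussianReal 0 (σ ^ 2).toNNReal
  /-- all initial gains and all increments are mutually independent -/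
  indep : iIndepFun
    (Sum.elim (fun i : ℕ => G i 0) (fun p : ℕ × ℕ => X p.1 p.2)) μ
  step : ∀ i t ω, G i (t + 1) ω = reflect (G i t ω + X i t ω)

/-- `V t ω` is the candidate set in slot `t`: a random finite set of vehicles, with at most two
elements during the trip `t = 1, …, T`, whose evolution is independent of the gains. -/
structure IsCandidateProcess {Ω : Type u} [MeasurableSpace Ω] (μ : Measure Ω) (T : ℕ)
    (G : ℕ → ℕ → Ω → ℝ) (V : ℕ → Ω → Finset ℕ) : Prop where
  measurable : ∀ t i, MeasurableSet {ω | i ∈ V t ω}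
  card_le_two : ∀ t ∈ Finset.Icc 1 T, ∀ ω, (V t ω).card ≤ 2
  indep : IndepFun (fun ω (t i : ℕ) => i ∈ V t ω) (fun ω (i t : ℕ) => G i t ω) μ

/-! A schedule is `a : ℕ → Option ℕ`: `a t = some i` if vehicle `i` is scheduled in slot `t`,
and `a t = none` if nothing is scheduled. -/

/-- Vehicle `i` has been scheduled before slot `t`. -/
def ScheduledBefore (a : ℕ → Option ℕ) (i t : ℕ) : Prop :=
  ∃ s ∈ Finset.Ico 1 t, a s = some i

/-- The last-seen time of vehicle `i` at slot `t`: the last slot `s < t` in which `i` was scheduled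
(used only when there is such a slot). -/
def lastSeen (a : ℕ → Option ℕ) (i t : ℕ) : ℕ :=
  ((Finset.Ico 1 t).filter (fun s => a s = some i)).sup id

/-- The upper confidence bound `ĝ_i + β √(t - τ_i)`, where `τ_i` is the last-seen time and `ĝ_i` the
last-seen gain, i.e. the gain at time `τ_i`. -/
noncomputable def ucb (β : ℝ) (g : ℕ → ℕ → ℝ) (a : ℕ → Option ℕ) (i t : ℕ) : ℝ :=
  g i (lastSeen a i t) + β * √((t : ℝ) - (lastSeen a i t : ℝ))

/-- `a` is a run over the slots `1, …, T` of the MASS algorithm with parameter `β`, for the gains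
`g` and the candidate sets `V`: a candidate that was never scheduled is scheduled
if there is one, and otherwise a candidate with maximum upper confidence bound is scheduled.
Ties are broken arbitrarily, and nothing is scheduled only if there is no candidate. -/
structure IsMASSRun (β : ℝ) (T : ℕ) (g : ℕ → ℕ → ℝ) (V : ℕ → Finset ℕ)
    (a : ℕ → Option ℕ) : Prop where
  none_iff : ∀ t ∈ Finset.Icc 1 T, (a t = none ↔ V t = ∅)
  mem : ∀ t ∈ Finset.Icc 1 T, ∀ i, a t = some i → i ∈ V t
  explore : ∀ t ∈ Finset.Icc 1 T, (∃ j ∈ V t, ¬ ScheduledBefore a j t) →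
    ∀ i, a t = some i → ¬ ScheduledBefore a i t
  exploit : ∀ t ∈ Finset.Icc 1 T, (∀ j ∈ V t, ScheduledBefore a j t) →
    ∀ i, a t = some i → ∀ j ∈ V t, ucb β g a j t ≤ ucb β g a i t

/-- The gain of the best candidate in slot `t` (zero if there is no candidate). -/
noncomputable def optimalGain (g : ℕ → ℕ → ℝ) (V : ℕ → Finset ℕ) (t : ℕ) : ℝ :=
  if h : (V t).Nonempty then (V t).sup' h (fun i => g i t) else 0

/-- The gain of the scheduled vehicle in slot `t` (zero if nothing is scheduled). -/
def scheduledGain (g : ℕ → ℕ → ℝ) (a : ℕ → Option ℕ) (t : ℕ) : ℝ :=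
  (a t).elim 0 (fun i => g i t)

/-- The learning regret over the slots `1, …, T`. -/
noncomputable def regret (T : ℕ) (g : ℕ → ℕ → ℝ) (V : ℕ → Finset ℕ) (a : ℕ → Option ℕ) : ℝ :=
  ∑ t ∈ Finset.Icc 1 T, (optimalGain g V t - scheduledGain g a t)

/-- The expected average learning regret `E[R(T)] / T`. -/
noncomputable def expectedAvgRegret {Ω : Type u} [MeasurableSpace Ω] (μ : Measure Ω) (T : ℕ)
    (G : ℕ → ℕ → Ω → ℝ) (V : ℕ → Ω → Finset ℕ) (a : ℕ → Ω → Option ℕ) : ℝ :=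
  (1 / (T : ℝ)) * ∫ ω, regret T (fun i t => G i t ω) (fun t => V t ω) (fun t => a t ω) ∂μ

/-- The number of arrivals during the trip: a vehicle arrives in slot `t ≥ 2` if it is a
candidate in slot `t` but was none in slot `t - 1`. -/
def arrivals (T : ℕ) (V : ℕ → Finset ℕ) : ℕ :=
  ∑ t ∈ Finset.Icc 2 T, (V t \ V (t - 1)).card

/-- The arrival rate: the expected number of arrivals per slot. -/
noncomputable def arrivalRate {Ω : Type u} [MeasurableSpace Ω] (μ : Measure Ω) (T : ℕ)
    (V : ℕ → Ω → Finset ℕ) : ℝ :=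
  (1 / (T : ℝ)) * ∫ ω, (arrivals T (fun t => V t ω) : ℝ) ∂μ

/-- A trip of length `T` under the random-walk model with parameter `σ` and a time-varying set of at
most two candidates, scheduled by MASS with parameter `β`. -/
structure IsMASSTrip {Ω : Type u} [MeasurableSpace Ω] (μ : Measure Ω) (σ β : ℝ) (T : ℕ)
    (G X : ℕ → ℕ → Ω → ℝ) (V : ℕ → Ω → Finset ℕ) (a : ℕ → Ω → Option ℕ) : Prop where
  walk : IsReflectedWalk μ σ G X
  candidates : IsCandidateProcess μ T G V
  measurable_schedule : ∀ t i, MeasurableSet {ω | a t ω = some i}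
  mass : ∀ ω, IsMASSRun β T (fun i t => G i t ω) (fun t => V t ω) (fun t => a t ω)

end SensorScheduling

/-! The regret is first bounded path by path, and expectations are taken afterwards. Only slots
where `i` is scheduled while the other candidate `j` is strictly better lose anything, and no loss
exceeds 1.

Losses in slots where the scheduled vehicle has not been scheduled since the candidate set last
changed are bounded by their number, at most twice the arrivals plus 2 (`card_firstSinceChange_le`).
In any other losing slot `t`, let `τ` be the last time `i` was seen and put `r = √(t - τ)`. If
neither path has moved faster than `β √(time)`, the UCB rule gives a loss of at most `2βr = r² ·
(2β/r)`, which is spread evenly over the `r²` slots in `(τ, t]`. Throughout these slots the two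
gains differ by at most `4βr`, so the share `2β/r` is at most `gapCharge β d = 16β² / (4β + |d|)` at
the current gap `d` (`loss_le_sum_gapCharge`). The intervals `(τ, t]` belonging to one vehicle are
disjoint, so each slot is charged at most once per ordered pair of candidates (`sum_repeat_le`). If
a path does move too fast, the loss is paid for by a `deviation` indicator. Together these give
`regret_le`.

In expectation, the gains of two vehicles at a fixed time are independent and uniform, since
reflection preserves the uniform law under symmetric steps. The mean gap charge is therefore of
order `β² log(1/β)`, which is of order `σ² log³(1/σ)` for the chosen `β`. Deviations are rare:
unfolding the reflected walk to the line gives a process with exactly Gaussian exponential moments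
(`lintegral_exp_unfolded`), to which a Chernoff and a union bound apply. Independence of the
candidate sets from the gains transfers these estimates for fixed pairs to random ones. -/

namespace SensorScheduling

/-! ### Deviations, gap charges and last-seen times -/

/-- The path `x` has moved, since some earlier time `s`, by more than `β √(t - s)`. -/
def Deviates (β : ℝ) (x : ℕ → ℝ) (t : ℕ) : Prop :=
  ∃ s < t, β * √((t : ℝ) - s) < |x t - x s|

open Classical in
/-- The indicator of `Deviates`. -/
noncomputable def deviation (β : ℝ) (x : ℕ → ℝ) (t : ℕ) : ℝ :=
  if Deviates β x t then 1 else 0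

/-- The price per slot of learning about a vehicle whose gain differs by `d` from that of the
other candidate. -/
noncomputable def gapCharge (β d : ℝ) : ℝ := 2 * β * (8 * β / (4 * β + |d|))

lemma deviation_nonneg (β : ℝ) (x : ℕ → ℝ) (t : ℕ) : 0 ≤ deviation β x t := by
  unfold deviation; split_ifs <;> norm_num

lemma gapCharge_nonneg {β : ℝ} (hβ : 0 < β) (d : ℝ) : 0 ≤ gapCharge β d := by
  unfold gapCharge; positivity

lemma abs_sub_le_of_not_deviates {β : ℝ} {x : ℕ → ℝ} {s t : ℕ} (h : ¬ Deviates β x t)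
    (hs : s < t) : |x t - x s| ≤ β * √((t : ℝ) - s) := by
  unfold Deviates at h
  push Not at h
  exact h s hs

lemma lastSeen_spec {a : ℕ → Option ℕ} {i t : ℕ} (h : ScheduledBefore a i t) :
    lastSeen a i t ∈ Finset.Ico 1 t ∧ a (lastSeen a i t) = some i := by
  obtain ⟨s, hs, has⟩ := h
  have hne : ((Finset.Ico 1 t).filter (fun s => a s = some i)).Nonempty :=
    ⟨s, Finset.mem_filter.2 ⟨hs, has⟩⟩
  obtain ⟨r, hr, hr'⟩ := Finset.exists_mem_eq_sup _ hne (id : ℕ → ℕ)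
  unfold lastSeen
  rw [hr']
  exact Finset.mem_filter.1 hr

lemma le_lastSeen {a : ℕ → Option ℕ} {i s t : ℕ} (hs : s ∈ Finset.Ico 1 t)
    (has : a s = some i) : s ≤ lastSeen a i t :=
  Finset.le_sup (f := id) (Finset.mem_filter.2 ⟨hs, has⟩)

/-! ### Pathwise bound on the regret -/

section Path

variable {β : ℝ} {T : ℕ} {g : ℕ → ℕ → ℝ} {V : ℕ → Finset ℕ} {a : ℕ → Option ℕ}

lemma scheduledGain_le_optimalGain (hrun : IsMASSRun β T g V a) {t : ℕ}
    (ht : t ∈ Finset.Icc 1 T) : scheduledGain g a t ≤ optimalGain g V t := by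
  unfold scheduledGain optimalGain
  rcases h : a t with _ | i
  · have hV := (hrun.none_iff t ht).1 h
    simp [hV]
  · have hi := hrun.mem t ht i h
    have hne : (V t).Nonempty := ⟨i, hi⟩
    simp only [Option.elim, hne, dif_pos]
    exact Finset.le_sup' (fun i => g i t) hi

lemma regret_nonneg (hrun : IsMASSRun β T g V a) : 0 ≤ regret T g V a :=
  Finset.sum_nonneg fun _ ht => sub_nonneg.2 (scheduledGain_le_optimalGain hrun ht)

/-- A positive loss means that the maximum is attained at an unscheduled candidate; the cardinality
bound leaves room for no third one. -/
lemma exists_pair_of_loss_pos (hrun : IsMASSRun β T g V a) {t : ℕ} (ht : t ∈ Finset.Icc 1 T)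
    (hcard : (V t).card ≤ 2) (hpos : 0 < optimalGain g V t - scheduledGain g a t) :
    ∃ i j, i ≠ j ∧ V t = {i, j} ∧ a t = some i ∧
      optimalGain g V t - scheduledGain g a t = g j t - g i t := by
  rcases h : a t with _ | i
  · have hV := (hrun.none_iff t ht).1 h
    simp [scheduledGain, optimalGain, h, hV] at hpos
  have hi := hrun.mem t ht i h
  have hne : (V t).Nonempty := ⟨i, hi⟩
  simp only [scheduledGain, optimalGain, h, hne, dif_pos, Option.elim] at hpos ⊢
  obtain ⟨j, hj, hj'⟩ := Finset.exists_mem_eq_sup' hne (fun i => g i t)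
  rw [hj'] at hpos ⊢
  have hij : i ≠ j := by rintro rfl; simp at hpos
  refine ⟨i, j, hij, ?_, rfl, rfl⟩
  symm
  apply Finset.eq_of_subset_of_card_le
  · intro x hx
    rcases Finset.mem_insert.1 hx with rfl | hx
    · exact hi
    · rwa [Finset.mem_singleton.1 hx]
  · rw [Finset.card_pair hij]; exact hcard

/-- If neither candidate deviates, the regret of scheduling `i` again is paid for by the slots since
`i` was last seen. -/
lemma loss_le_sum_gapCharge (hβ : 0 < β) (hrun : IsMASSRun β T g V a) {i j t : ℕ}
    (ht : t ∈ Finset.Icc 1 T) (hV : V t = {i, j}) (hat : a t = some i)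
    (hpos : 0 < g j t - g i t) (hsch : ScheduledBefore a i t)
    (hi : ¬ Deviates β (g i) t) (hj : ¬ Deviates β (g j) t) :
    g j t - g i t ≤ ∑ s ∈ Finset.Ioc (lastSeen a i t) t, gapCharge β (g i s - g j s) := by
  -- An unseen candidate would have forced the choice of an unseen vehicle, which `i` is not.
  have hall : ∀ k ∈ V t, ScheduledBefore a k t := by
    by_contra! hcon
    exact hrun.explore t ht hcon i hat hsch
  have hucb := hrun.exploit t ht hall i hat j (by simp [hV])
  have hτi := (lastSeen_spec hsch).1
  have hτj := (lastSeen_spec (hall j (by simp [hV]))).1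
  unfold ucb at hucb
  set τ := lastSeen a i t with hτ
  rw [Finset.mem_Ico] at hτi hτj
  have h1 := abs_le.1 (abs_sub_le_of_not_deviates hi hτi.2)
  have h2 := abs_le.1 (abs_sub_le_of_not_deviates hj hτj.2)
  have hL : (1 : ℝ) ≤ (t : ℝ) - τ := by
    have : (τ : ℝ) + 1 ≤ t := by exact_mod_cast hτi.2
    linarith
  have hr : 1 ≤ √((t : ℝ) - τ) := Real.one_le_sqrt.2 hL
  have hrsq : √((t : ℝ) - τ) * √((t : ℝ) - τ) = (t : ℝ) - τ :=
    Real.mul_self_sqrt (by linarith)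
  set r := √((t : ℝ) - τ) with hrdef
  -- The bound of `j` dominates its current gain, the bound of `i` dominates that of `j`, and `i`
  -- has dropped by at most `βr` since `τ`.
  have hloss : g j t - g i t ≤ 2 * β * r := by linarith [h1.1, h2.2]
  have hterm : ∀ s ∈ Finset.Ioc τ t, 2 * β / r ≤ gapCharge β (g i s - g j s) := by
    intro s hs
    rw [Finset.mem_Ioc] at hs
    have key : ∀ k, ¬ Deviates β (g k) t → |g k t - g k s| ≤ β * r := by
      intro k hk
      rcases hs.2.eq_or_lt with rfl | hlt
      · simp only [sub_self, abs_zero]; positivity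
      · refine (abs_sub_le_of_not_deviates hk hlt).trans ?_
        have : (τ : ℝ) ≤ s := by exact_mod_cast hs.1.le
        exact mul_le_mul_of_nonneg_left (Real.sqrt_le_sqrt (by linarith)) hβ.le
    have hgap : |g i s - g j s| ≤ 4 * β * r := by
      have ha := abs_le.1 (key i hi)
      have hb := abs_le.1 (key j hj)
      rw [abs_le]
      constructor <;> nlinarith [ha.1, ha.2, hb.1, hb.2]
    unfold gapCharge
    -- As `r ≥ 1`, the denominator `4β + |d|` is at most `4β + 4βr ≤ 8βr`.
    rw [mul_div_assoc', div_le_div_iff₀ (by linarith) (by positivity)]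
    nlinarith [mul_pos hβ hβ]
  calc g j t - g i t ≤ 2 * β * r := hloss
    _ = ((t : ℝ) - τ) * (2 * β / r) := by rw [← hrsq]; field_simp
    _ = ∑ s ∈ Finset.Ioc τ t, 2 * β / r := by
        rw [Finset.sum_const, Nat.card_Ioc, nsmul_eq_mul, Nat.cast_sub hτi.2.le]
    _ ≤ _ := Finset.sum_le_sum hterm

/-- The vehicle scheduled in slot `t` has not yet been scheduled since the candidate set last
changed. -/
def FirstSinceChange (V : ℕ → Finset ℕ) (a : ℕ → Option ℕ) (t : ℕ) : Prop :=
  ∀ s ∈ Finset.Ico 1 t, a s = a t → ∃ r ∈ Finset.Icc s t, V r ≠ V t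

lemma exists_run_start (V : ℕ → Finset ℕ) {t : ℕ} (ht : 1 ≤ t) :
    ∃ u ∈ Finset.Icc 1 t, (∀ r ∈ Finset.Icc u t, V r = V t) ∧ (u = 1 ∨ V (u - 1) ≠ V u) := by
  classical
  have hex : ∃ u, 1 ≤ u ∧ u ≤ t ∧ ∀ r ∈ Finset.Icc u t, V r = V t := by
    refine ⟨t, ht, le_rfl, fun r hr => ?_⟩
    rw [Finset.mem_Icc] at hr
    rw [le_antisymm hr.2 hr.1]
  obtain ⟨h1, h2, h3⟩ := Nat.find_spec hex
  have hmin := fun m => Nat.find_min hex (m := m)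
  set u := Nat.find hex
  refine ⟨u, Finset.mem_Icc.2 ⟨h1, h2⟩, h3, ?_⟩
  by_contra! hcon
  refine hmin (u - 1) (by omega) ⟨by omega, by omega, fun r hr => ?_⟩
  rw [Finset.mem_Icc] at hr
  rcases Nat.lt_or_ge r u with hlt | hge
  · have : r = u - 1 := by omega
    rw [this, hcon.2]
    exact h3 u (Finset.mem_Icc.2 ⟨le_rfl, h2⟩)
  · exact h3 r (Finset.mem_Icc.2 ⟨hge, hr.2⟩)

-- Within a maximal run of constant candidate sets each vehicle can be counted only once, so such a
-- slot is determined by the start of its run and its scheduled vehicle. Every run start other than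
-- slot 1 brings an arrival, and a start carries at most two vehicles.
open Classical in
lemma card_firstSinceChange_le (hcard : ∀ t ∈ Finset.Icc 1 T, (V t).card ≤ 2)
    {A : Finset ℕ} (hA : A ⊆ Finset.Icc 1 T) (hA2 : ∀ t ∈ A, (V t).card = 2)
    {I : ℕ → ℕ} (hI : ∀ t ∈ A, I t ∈ V t ∧ a t = some (I t))
    (hfirst : ∀ t ∈ A, FirstSinceChange V a t) :
    A.card ≤ 2 * arrivals T V + 2 := by
  choose! U hU hconst hstart using
    fun (t : ℕ) (ht : t ∈ A) => exists_run_start V (Finset.mem_Icc.1 (hA ht)).1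
  set S : Finset (Σ _ : ℕ, ℕ) :=
    ((Finset.Icc 1 T).filter fun u => u = 1 ∨ (V u \ V (u - 1)).Nonempty).sigma V with hS
  have hmaps : ∀ t ∈ A, (⟨U t, I t⟩ : Σ _ : ℕ, ℕ) ∈ S := by
    intro t ht
    have hu := Finset.mem_Icc.1 (hU t ht)
    have htT := Finset.mem_Icc.1 (hA ht)
    have hVu : V (U t) = V t := hconst t ht _ (Finset.mem_Icc.2 ⟨le_rfl, hu.2⟩)
    rw [hS, Finset.mem_sigma, Finset.mem_filter, Finset.mem_Icc]
    refine ⟨⟨⟨hu.1, hu.2.trans htT.2⟩, ?_⟩, by simpa [hVu] using (hI t ht).1⟩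
    rcases eq_or_ne (U t) 1 with h1 | h1
    · exact Or.inl h1
    right
    -- Passing from at most two candidates to a different set of exactly two must add a vehicle;
    -- this is where `hA2` is needed.
    have hne := (hstart t ht).resolve_left h1
    dsimp only
    by_contra hempty
    rw [Finset.not_nonempty_iff_eq_empty, Finset.sdiff_eq_empty_iff_subset] at hempty
    refine hne (Finset.eq_of_subset_of_card_le hempty ?_).symm
    rw [hVu, hA2 t ht]
    exact hcard _ (Finset.mem_Icc.2 ⟨by omega, by omega⟩)
  have aux : ∀ t ∈ A, ∀ t' ∈ A, U t = U t' → I t = I t' → ¬ t < t' := by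
    intro t ht t' ht' hUU hII hlt
    have hu := Finset.mem_Icc.1 (hU t ht)
    have htT := Finset.mem_Icc.1 (hA ht)
    obtain ⟨r, hr, hr'⟩ := hfirst t' ht' t (Finset.mem_Ico.2 ⟨htT.1, hlt⟩)
      (by rw [(hI t ht).2, (hI t' ht').2, hII])
    rw [Finset.mem_Icc] at hr
    exact hr' (hconst t' ht' r (Finset.mem_Icc.2 ⟨by omega, hr.2⟩))
  have hinj : Set.InjOn (fun t => (⟨U t, I t⟩ : Σ _ : ℕ, ℕ)) A := by
    intro t ht t' ht' h
    simp only [Sigma.mk.injEq, heq_eq_eq] at h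
    exact le_antisymm (not_lt.1 (aux t' ht' t ht h.1.symm h.2.symm))
      (not_lt.1 (aux t ht t' ht' h.1 h.2))
  calc A.card ≤ S.card := Finset.card_le_card_of_injOn _ hmaps hinj
    _ = ∑ u ∈ (Finset.Icc 1 T).filter (fun u => u = 1 ∨ (V u \ V (u - 1)).Nonempty),
          (V u).card := Finset.card_sigma _ _
    _ = ∑ u ∈ Finset.Icc 1 T, if u = 1 ∨ (V u \ V (u - 1)).Nonempty then (V u).card else 0 :=
        Finset.sum_filter _ _
    _ ≤ ∑ u ∈ Finset.Icc 1 T, ((if u = 1 then 2 else 0) +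
          if 2 ≤ u then 2 * (V u \ V (u - 1)).card else 0) := by
        refine Finset.sum_le_sum fun u hu => ?_
        have h2 := hcard u hu
        rw [Finset.mem_Icc] at hu
        by_cases h1 : u = 1
        · simp only [h1, true_or, if_true]
          rw [h1] at h2
          omega
        · have h2u : 2 ≤ u := by omega
          simp only [h1, false_or, if_false, h2u, if_true]
          split_ifs with hne
          · have := hne.card_pos
            omega
          · omega
    _ ≤ 2 * arrivals T V + 2 := by
        rw [Finset.sum_add_distrib, add_comm]
        gcongr
        · rw [← Finset.sum_filter, ← Finset.mul_sum]
          refine Nat.mul_le_mul_left 2 (Finset.sum_le_sum_of_subset ?_)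
          intro u hu
          rw [Finset.mem_filter, Finset.mem_Icc] at hu
          exact Finset.mem_Icc.2 ⟨hu.2, hu.1.2⟩
        · rw [Finset.sum_ite_eq']
          split_ifs <;> simp

/-- For a fixed scheduled vehicle the intervals `(lastSeen, t]` are disjoint, since `t` itself
counts as seen at any later slot. On each interval the candidate set is constant, so the charged
pair is a pair of candidates in every slot that pays. -/
lemma sum_repeat_le {B : Finset ℕ} (hB : B ⊆ Finset.Icc 1 T) {I J : ℕ → ℕ}
    (hIJ : ∀ t ∈ B, I t ≠ J t) (hV : ∀ t ∈ B, V t = {I t, J t})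
    (ha : ∀ t ∈ B, a t = some (I t)) (hrep : ∀ t ∈ B, ¬ FirstSinceChange V a t)
    {w : ℕ → ℕ × ℕ → ℝ} (hw : ∀ s p, 0 ≤ w s p) :
    ∑ t ∈ B, ∑ s ∈ Finset.Ioc (lastSeen a (I t) t) t, w s (I t, J t) ≤
      ∑ s ∈ Finset.Icc 1 T, ∑ p ∈ (V s).offDiag, w s p := by
  classical
  have hconst : ∀ t ∈ B, ∀ s ∈ Finset.Ioc (lastSeen a (I t) t) t, V s = V t := by
    intro t ht s hs
    have h := hrep t ht
    unfold FirstSinceChange at h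
    push Not at h
    obtain ⟨s₀, hs₀, has₀, hc⟩ := h
    rw [ha t ht] at has₀
    have := le_lastSeen hs₀ has₀
    rw [Finset.mem_Ioc] at hs
    exact hc s (Finset.mem_Icc.2 ⟨by omega, hs.2⟩)
  rw [Finset.sum_sigma', Finset.sum_sigma']
  set F : (Σ _ : ℕ, ℕ) → (Σ _ : ℕ, ℕ × ℕ) := fun x => ⟨x.2, (I x.1, J x.1)⟩ with hF
  have aux : ∀ t ∈ B, ∀ t' ∈ B, ∀ s, s ≤ t → lastSeen a (I t') t' < s → I t = I t' →
      ¬ t < t' := by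
    intro t ht t' ht' s hs hs' hII hlt
    have := le_lastSeen (a := a) (i := I t') (s := t) (t := t')
      (Finset.mem_Ico.2 ⟨(Finset.mem_Icc.1 (hB ht)).1, hlt⟩) (by rw [ha t ht, hII])
    omega
  have hinj : Set.InjOn F (B.sigma fun t => Finset.Ioc (lastSeen a (I t) t) t) := by
    rintro ⟨t, s⟩ hx ⟨t', s'⟩ hx' h
    simp only [Finset.coe_sigma, Set.mem_sigma_iff, Finset.mem_coe, Finset.mem_Ioc] at hx hx'
    simp only [hF, Sigma.mk.injEq, heq_eq_eq, Prod.mk.injEq] at h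
    obtain ⟨rfl, hI, -⟩ := h
    have : t = t' := le_antisymm
      (not_lt.1 (aux t' hx'.1 t hx.1 s hx'.2.2 hx.2.1 hI.symm))
      (not_lt.1 (aux t hx.1 t' hx'.1 s hx.2.2 hx'.2.1 hI))
    rw [this]
  calc _ = ∑ y ∈ (B.sigma fun t => Finset.Ioc (lastSeen a (I t) t) t).image F, w y.1 y.2 := by
        rw [Finset.sum_image hinj]
    _ ≤ _ := by
        refine Finset.sum_le_sum_of_subset_of_nonneg ?_ fun _ _ _ => hw _ _
        intro y hy
        obtain ⟨⟨t, s⟩, hx, rfl⟩ := Finset.mem_image.1 hy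
        rw [Finset.mem_sigma] at hx
        have hVs := hconst t hx.1 s hx.2
        have h1 := Finset.mem_Ioc.1 hx.2
        have h2 := Finset.mem_Icc.1 (hB hx.1)
        simp only [hF, Finset.mem_sigma, Finset.mem_Icc, Finset.mem_offDiag]
        simp only at hVs h1 h2
        refine ⟨⟨by omega, by omega⟩, ?_, ?_, hIJ t hx.1⟩ <;> simp [hVs, hV t hx.1]

/-- A pathwise bound on the learning regret. -/
theorem regret_le (hβ : 0 < β) (hg : ∀ i t, g i t ∈ Set.Icc (0 : ℝ) 1)
    (hcard : ∀ t ∈ Finset.Icc 1 T, (V t).card ≤ 2) (hrun : IsMASSRun β T g V a) :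
    regret T g V a ≤ 2 * (arrivals T V : ℝ) + 2 + ∑ t ∈ Finset.Icc 1 T, ∑ p ∈ (V t).offDiag,
      (gapCharge β (g p.1 t - g p.2 t) + (deviation β (g p.1) t + deviation β (g p.2) t)) := by
  classical
  set loss : ℕ → ℝ := fun t => optimalGain g V t - scheduledGain g a t with hloss
  set P := (Finset.Icc 1 T).filter fun t => 0 < loss t with hP
  have hPT : P ⊆ Finset.Icc 1 T := Finset.filter_subset _ _
  choose! I J hIJ hV ha hval using fun (t : ℕ) (ht : t ∈ P) =>
    exists_pair_of_loss_pos hrun (hPT ht) (hcard t (hPT ht)) (Finset.mem_filter.1 ht).2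
  set A := P.filter fun t => FirstSinceChange V a t with hA
  set B := P.filter fun t => ¬ FirstSinceChange V a t with hB
  have hdev0 : ∀ t, ∀ p : ℕ × ℕ, 0 ≤ deviation β (g p.1) t + deviation β (g p.2) t :=
    fun t p => add_nonneg (deviation_nonneg _ _ _) (deviation_nonneg _ _ _)
  have hone : ∀ t ∈ P, loss t ≤ 1 := by
    intro t ht
    have h1 := hg (I t) t
    have h2 := hg (J t) t
    simp only [hloss, hval t ht]
    linarith [h1.1, h2.2]
  have hbound : ∀ t ∈ B, loss t ≤
      (∑ s ∈ Finset.Ioc (lastSeen a (I t) t) t, gapCharge β (g (I t) s - g (J t) s)) +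
      ∑ p ∈ (V t).offDiag, (deviation β (g p.1) t + deviation β (g p.2) t) := by
    intro t ht
    obtain ⟨htP, hrep⟩ := Finset.mem_filter.1 ht
    have hmem : (I t, J t) ∈ (V t).offDiag := by
      simp [Finset.mem_offDiag, hV t htP, hIJ t htP]
    have hsum := Finset.single_le_sum (fun p _ => hdev0 t p) hmem
    have hgap : 0 ≤ ∑ s ∈ Finset.Ioc (lastSeen a (I t) t) t,
        gapCharge β (g (I t) s - g (J t) s) :=
      Finset.sum_nonneg fun _ _ => gapCharge_nonneg hβ _
    -- A deviating candidate makes one indicator equal to 1, which covers any loss; otherwise the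
    -- loss is spread over gap charges.
    by_cases hd : Deviates β (g (I t)) t ∨ Deviates β (g (J t)) t
    · have h1 : 1 ≤ deviation β (g (I t)) t + deviation β (g (J t)) t := by
        have h3 := deviation_nonneg β (g (I t)) t
        have h4 := deviation_nonneg β (g (J t)) t
        rcases hd with hd | hd
        · have : deviation β (g (I t)) t = 1 := by simp [deviation, hd]
          linarith
        · have : deviation β (g (J t)) t = 1 := by simp [deviation, hd]
          linarith
      have := hone t htP
      simp only at hsum
      linarith
    · push Not at hd
      have hsch : ScheduledBefore a (I t) t := by
        unfold FirstSinceChange at hrep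
        push Not at hrep
        obtain ⟨s, hs, has, -⟩ := hrep
        exact ⟨s, hs, has.trans (ha t htP)⟩
      have hpos := (Finset.mem_filter.1 htP).2
      simp only [hloss, hval t htP] at hpos ⊢
      have := loss_le_sum_gapCharge hβ hrun (hPT htP) (hV t htP) (ha t htP) hpos hsch hd.1 hd.2
      have h0 := hdev0 t (I t, J t)
      linarith
  have hAcard : (A.card : ℝ) ≤ 2 * (arrivals T V : ℝ) + 2 := by
    have := card_firstSinceChange_le (a := a) hcard (A := A) (I := I)
      ((Finset.filter_subset _ _).trans hPT)
      (fun t ht => by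
        have htP := (Finset.mem_filter.1 ht).1
        rw [hV t htP, Finset.card_pair (hIJ t htP)])
      (fun t ht => by
        have htP := (Finset.mem_filter.1 ht).1
        exact ⟨by simp [hV t htP], ha t htP⟩)
      (fun t ht => (Finset.mem_filter.1 ht).2)
    exact_mod_cast this
  have hBP : ∀ t ∈ B, t ∈ P := fun t ht => (Finset.mem_filter.1 ht).1
  have hBsum := sum_repeat_le (V := V) (a := a) (T := T) (B := B) (I := I) (J := J)
    (fun t ht => hPT (hBP t ht)) (fun t ht => hIJ t (hBP t ht)) (fun t ht => hV t (hBP t ht))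
    (fun t ht => ha t (hBP t ht)) (fun t ht => (Finset.mem_filter.1 ht).2)
    (w := fun s p => gapCharge β (g p.1 s - g p.2 s)) (fun s p => gapCharge_nonneg hβ _)
  have hdevsum : ∑ t ∈ B, ∑ p ∈ (V t).offDiag, (deviation β (g p.1) t + deviation β (g p.2) t) ≤
      ∑ t ∈ Finset.Icc 1 T, ∑ p ∈ (V t).offDiag,
        (deviation β (g p.1) t + deviation β (g p.2) t) :=
    Finset.sum_le_sum_of_subset_of_nonneg (fun t ht => hPT (hBP t ht))
      fun t _ _ => Finset.sum_nonneg fun p _ => hdev0 t p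
  have hregret : regret T g V a ≤ ∑ t ∈ P, loss t := by
    unfold regret
    rw [hP, Finset.sum_filter]
    refine Finset.sum_le_sum fun t _ => ?_
    split_ifs with h
    · exact le_rfl
    · exact not_lt.1 h
  have hsplit : ∑ t ∈ P, loss t = ∑ t ∈ A, loss t + ∑ t ∈ B, loss t :=
    (Finset.sum_filter_add_sum_filter_not P _ _).symm
  have hAsum : ∑ t ∈ A, loss t ≤ A.card := by
    calc ∑ t ∈ A, loss t ≤ ∑ t ∈ A, (1 : ℝ) :=
          Finset.sum_le_sum fun t ht => hone t (Finset.mem_filter.1 ht).1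
      _ = A.card := by simp
  have hBle := Finset.sum_le_sum hbound
  rw [Finset.sum_add_distrib] at hBle
  simp only [Finset.sum_add_distrib] at hBsum hdevsum hBle ⊢
  linarith

end Path

/-! ### Reflection as folding of the line, and stationarity of the uniform law -/

lemma reflect_eq_abs (x : ℝ) : reflect x = 2 * |x / 2 - round (x / 2)| := by
  rw [abs_sub_round_eq_min]
  unfold reflect
  split_ifs with h
  · rw [min_eq_left (by linarith)]
  · rw [min_eq_right (by linarith)]
    ring

lemma reflect_le_abs_sub (x : ℝ) (n : ℤ) : reflect x ≤ |x - 2 * n| := by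
  rw [reflect_eq_abs]
  have := round_le (x / 2) n
  have h2 : |x - 2 * n| = 2 * |x / 2 - n| := by
    rw [← abs_of_pos (show (0 : ℝ) < 2 by norm_num), ← abs_mul, abs_of_pos (show (0 : ℝ) < 2 by norm_num)]
    congr 1
    ring
  linarith

lemma exists_reflect_eq_abs_sub (x : ℝ) : ∃ n : ℤ, reflect x = |x - 2 * n| := by
  refine ⟨round (x / 2), ?_⟩
  rw [reflect_eq_abs, ← abs_of_pos (show (0 : ℝ) < 2 by norm_num), ← abs_mul,
    abs_of_pos (show (0 : ℝ) < 2 by norm_num)]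
  congr 1
  ring

/-- `reflect` is the distance to the set of even integers, and a distance function is 1-Lipschitz.
-/
lemma abs_reflect_sub_le (x y : ℝ) : |reflect x - reflect y| ≤ |x - y| := by
  have key : ∀ x y, reflect x ≤ reflect y + |x - y| := by
    intro x y
    obtain ⟨n, hn⟩ := exists_reflect_eq_abs_sub y
    have h1 := reflect_le_abs_sub x n
    have h2 := abs_sub_le x y (2 * n)
    linarith
  rw [abs_sub_le_iff]
  have h1 := key x y
  have h2 := key y x
  rw [abs_sub_comm y x] at h2
  constructor <;> linarith

lemma reflect_add_two_mul_int (x : ℝ) (n : ℤ) : reflect (x + 2 * n) = reflect x := by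
  have : (x + 2 * n) / 2 = x / 2 + n := by ring
  simp only [reflect, this, Int.fract_add_intCast]

lemma reflect_periodic : Function.Periodic reflect 2 := fun x => by
  simpa using reflect_add_two_mul_int x 1

lemma reflect_neg (x : ℝ) : reflect (-x) = reflect x := by
  have key : ∀ x, reflect (-x) ≤ reflect x := by
    intro x
    obtain ⟨n, hn⟩ := exists_reflect_eq_abs_sub x
    have h := reflect_le_abs_sub (-x) (-n)
    rw [hn]
    rw [← abs_neg] at h
    convert h using 2
    push_cast
    ring
  exact le_antisymm (key x) (by simpa using key (-x))

lemma reflect_of_mem_Icc {x : ℝ} (hx : x ∈ Set.Icc (0 : ℝ) 1) : reflect x = x := by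
  have hf : Int.fract (x / 2) = x / 2 :=
    Int.fract_eq_self.2 ⟨by linarith [hx.1], by linarith [hx.2]⟩
  unfold reflect
  rw [hf]
  split_ifs with h
  · ring
  · linarith [hx.2]

lemma continuous_reflect : Continuous reflect :=
  (LipschitzWith.of_dist_le_mul (K := 1) fun x y => by
    simpa [Real.dist_eq] using abs_reflect_sub_le x y).continuous

/-- The slope of `reflect` at `y`. -/
noncomputable def foldSign (y : ℝ) : ℝ :=
  if 0 ≤ y / 2 - round (y / 2) then 1 else -1

lemma measurableSet_foldSign : MeasurableSet {y : ℝ | 0 ≤ y / 2 - round (y / 2)} := by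
  have : Measurable fun y : ℝ => ((round (y / 2) : ℤ) : ℝ) := by
    simp only [round_eq]
    exact measurable_from_top.comp (Int.measurable_floor.comp (by fun_prop))
  exact measurableSet_le measurable_const (by fun_prop)

lemma measurable_foldSign : Measurable foldSign :=
  Measurable.ite measurableSet_foldSign measurable_const measurable_const

lemma foldSign_eq_or (y : ℝ) : foldSign y = 1 ∨ foldSign y = -1 := by
  unfold foldSign; split_ifs <;> simp

/-- A step of the reflected walk lifts to a step, with the sign adjusted, of the unfolded walk. -/
lemma reflect_reflect_add (y x : ℝ) : reflect (reflect y + x) = reflect (y + foldSign y * x) := by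
  rw [reflect_eq_abs y]
  unfold foldSign
  split_ifs with h
  · rw [abs_of_nonneg h, ← reflect_add_two_mul_int _ (round (y / 2))]
    congr 1
    ring
  · rw [abs_of_neg (not_le.1 h), ← reflect_neg, ← reflect_add_two_mul_int _ (round (y / 2))]
    congr 1
    ring

/-- Averaged over a symmetric pair of steps, reflection preserves the uniform law. -/
lemma intervalIntegral_reflect_add_sub {φ : ℝ → ℝ}
    (hφ : ∀ a b, IntervalIntegrable (fun y => φ (reflect y)) volume a b) (x : ℝ) :
    (∫ u in (0 : ℝ)..1, φ (reflect (u + x))) + ∫ u in (0 : ℝ)..1, φ (reflect (u + -x)) =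
      2 * ∫ u in (0 : ℝ)..1, φ u := by
  have hneg : ∀ a b, ∫ u in a..b, φ (reflect u) = ∫ u in -b..-a, φ (reflect u) := by
    intro a b
    rw [← intervalIntegral.integral_comp_neg]
    simp only [reflect_neg]
  have hper : Function.Periodic (fun y => φ (reflect y)) 2 := fun y => by
    simp only [reflect_periodic y]
  have h1 : ∫ u in (0 : ℝ)..1, φ (reflect (u + x)) = ∫ u in x..x + 1, φ (reflect u) := by
    rw [intervalIntegral.integral_comp_add_right (fun y => φ (reflect y))]
    simp [add_comm]
  -- Evenness turns the interval `[-x, 1 - x]` into `[x - 1, x]`; joined to `[x, x + 1]` it makes up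
  -- a full period, which covers `[0, 1]` twice.
  have h2 : ∫ u in (0 : ℝ)..1, φ (reflect (u + -x)) = ∫ u in x - 1..x, φ (reflect u) := by
    rw [intervalIntegral.integral_comp_add_right (fun y => φ (reflect y)), hneg]
    congr 1 <;> ring
  have h3 := hper.intervalIntegral_add_eq (x - 1) (-1)
  have h4 : ∫ u in (-1 : ℝ)..0, φ (reflect u) = ∫ u in (0 : ℝ)..1, φ (reflect u) := by
    rw [hneg]; norm_num
  have h5 : ∫ u in (0 : ℝ)..1, φ (reflect u) = ∫ u in (0 : ℝ)..1, φ u := by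
    refine intervalIntegral.integral_congr fun u hu => ?_
    rw [Set.uIcc_of_le zero_le_one] at hu
    simp only [reflect_of_mem_Icc hu]
  rw [h1, h2, add_comm, intervalIntegral.integral_add_adjacent_intervals (hφ _ _) (hφ _ _)]
  have e1 : x - 1 + 2 = x + 1 := by ring
  have e2 : (-1 : ℝ) + 2 = 1 := by ring
  rw [e1, e2] at h3
  rw [h3, ← intervalIntegral.integral_add_adjacent_intervals (hφ (-1) 0) (hφ 0 1), h4, h5]
  ring

/-- The uniform distribution on `[0, 1]` is stationary for a reflected step with Gaussian
increments. -/
lemma map_reflect_add_gaussianReal (v : NNReal) :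
    ((volume.restrict (Set.Icc (0 : ℝ) 1)).prod (gaussianReal 0 v)).map
      (fun p => reflect (p.1 + p.2)) = volume.restrict (Set.Icc (0 : ℝ) 1) := by
  set U := volume.restrict (Set.Icc (0 : ℝ) 1) with hU
  set N := gaussianReal 0 v
  have : IsProbabilityMeasure U := ⟨by simp [hU]⟩
  have hmeas : Measurable fun p : ℝ × ℝ => reflect (p.1 + p.2) :=
    continuous_reflect.measurable.comp (by fun_prop)
  have : IsProbabilityMeasure ((U.prod N).map fun p => reflect (p.1 + p.2)) :=
    Measure.isProbabilityMeasure_map hmeas.aemeasurable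
  ext s hs
  rw [← measureReal_eq_measureReal_iff]
  set φ : ℝ → ℝ := s.indicator 1 with hφ
  have hφm : Measurable φ := measurable_one.indicator hs
  have hφb : ∀ x, ‖φ x‖ ≤ 1 := fun x => by
    simp only [hφ, Set.indicator]; split_ifs <;> simp
  have hint : ∀ (ν : Measure (ℝ × ℝ)) [IsFiniteMeasure ν],
      Integrable (fun p => φ (reflect (p.1 + p.2))) ν := fun ν _ =>
    Integrable.of_bound (hφm.comp hmeas).aestronglyMeasurable 1 (ae_of_all _ fun _ => hφb _)
  have hUint : ∀ f : ℝ → ℝ, ∫ u, f u ∂U = ∫ u in (0 : ℝ)..1, f u := fun f => by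
    rw [intervalIntegral.integral_of_le zero_le_one, hU, integral_Icc_eq_integral_Ioc]
  have hφi : ∀ a b, IntervalIntegrable (fun y => φ (reflect y)) volume a b := fun a b =>
    (intervalIntegrable_const (c := (1 : ℝ))).mono_fun
      (hφm.comp continuous_reflect.measurable).aestronglyMeasurable
      (ae_of_all _ fun x => by simpa using hφb _)
  have hreal : ∀ ν : Measure ℝ, ν.real s = ∫ x, φ x ∂ν := fun ν => by
    rw [hφ, integral_indicator_one hs]
  rw [hreal, hreal, integral_map hmeas.aemeasurable hφm.aestronglyMeasurable,
    integral_prod_symm _ (hint _)]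
  set A : ℝ → ℝ := fun x => ∫ u, φ (reflect (u + x)) ∂U
  have hAi : Integrable A N := (hint (U.prod N)).integral_prod_right
  -- The Gaussian law is symmetric, so the steps `x` and `-x` can be averaged, and for such a pair
  -- the uniform law is preserved.
  have hsymm : ∫ x, A (-x) ∂N = ∫ x, A x ∂N := by
    have hN : N.map (fun x => -x) = N := by simpa using gaussianReal_map_neg (μ := 0) (v := v)
    conv_rhs => rw [← hN]
    rw [integral_map (by fun_prop) (by rw [hN]; exact hAi.aestronglyMeasurable)]
  have hAi' : Integrable (fun x => A (-x)) N := by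
    have hN : N.map (fun x => -x) = N := by simpa using gaussianReal_map_neg (μ := 0) (v := v)
    exact Integrable.comp_measurable (g := A) (f := fun x => -x) (by rw [hN]; exact hAi)
      measurable_neg
  have hsum : ∫ x, A x ∂N + ∫ x, A (-x) ∂N = 2 * ∫ x, φ x ∂U := by
    rw [← integral_add hAi hAi']
    have : ∀ x, A x + A (-x) = 2 * ∫ u, φ u ∂U := fun x => by
      simp only [A, hUint]
      exact intervalIntegral_reflect_add_sub hφi x
    simp [this]
  rw [hsymm] at hsum
  change ∫ x, A x ∂N = _
  linarith

/-! ### The reflected Gaussian walk: independence, marginals and concentration -/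

section Walk

variable {Ω : Type u} {G X : ℕ → ℕ → Ω → ℝ}

/-- The σ-algebra generated by the initial gains and increments with index in `S`. -/
@[reducible] def noiseSigma (G X : ℕ → ℕ → Ω → ℝ) (S : Set (ℕ ⊕ ℕ × ℕ)) : MeasurableSpace Ω :=
  ⨆ k ∈ S, MeasurableSpace.comap
    (Sum.elim (fun i : ℕ => G i 0) (fun p : ℕ × ℕ => X p.1 p.2) k) inferInstance

/-- The indices of the noise of vehicle `i` before time `t`. -/
def pastIndices (i t : ℕ) : Set (ℕ ⊕ ℕ × ℕ) :=
  {k | Sum.elim (fun j => j = i) (fun p => p.1 = i ∧ p.2 < t) k}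

lemma noiseSigma_mono {S S' : Set (ℕ ⊕ ℕ × ℕ)} (h : S ⊆ S') :
    noiseSigma G X S ≤ noiseSigma G X S' :=
  biSup_mono h

lemma pastIndices_mono (i : ℕ) {s t : ℕ} (h : s ≤ t) : pastIndices i s ⊆ pastIndices i t := by
  rintro (j | p) hk
  · exact hk
  · exact ⟨hk.1, lt_of_lt_of_le hk.2 h⟩

lemma measurable_noise {S : Set (ℕ ⊕ ℕ × ℕ)} {k : ℕ ⊕ ℕ × ℕ} (hk : k ∈ S) :
    Measurable[noiseSigma G X S]
      (Sum.elim (fun i : ℕ => G i 0) (fun p : ℕ × ℕ => X p.1 p.2) k) :=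
  Measurable.of_comap_le (le_biSup (fun k => MeasurableSpace.comap
    (Sum.elim (fun i : ℕ => G i 0) (fun p : ℕ × ℕ => X p.1 p.2) k) inferInstance) hk)

lemma measurable_incr_of_mem {S : Set (ℕ ⊕ ℕ × ℕ)} {i t : ℕ} (hk : Sum.inr (i, t) ∈ S) :
    Measurable[noiseSigma G X S] (X i t) :=
  measurable_noise (G := G) hk

variable [mΩ : MeasurableSpace Ω] {μ : Measure Ω} {σ : ℝ}

namespace IsReflectedWalk

variable (hw : IsReflectedWalk μ σ G X)
include hw

/-- This adaptedness yields both independences used later: a gain from the next increment, and the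
gains of distinct vehicles from each other. -/
lemma measurable_gain_past (i t : ℕ) : Measurable[noiseSigma G X (pastIndices i t)] (G i t) := by
  induction t with
  | zero =>
    exact measurable_noise (X := X) (k := Sum.inl i) rfl
  | succ t ih =>
    have h1 : Measurable[noiseSigma G X (pastIndices i (t + 1))] (G i t) :=
      ih.mono (noiseSigma_mono (pastIndices_mono i t.le_succ)) le_rfl
    have h2 : Measurable[noiseSigma G X (pastIndices i (t + 1))] (X i t) :=
      measurable_incr_of_mem ⟨rfl, t.lt_succ_self⟩
    have h3 : G i (t + 1) = fun ω => reflect (G i t ω + X i t ω) := funext (hw.step i t)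
    rw [h3]
    exact continuous_reflect.measurable.comp (h1.add h2)

lemma measurable_gain (i t : ℕ) : Measurable (G i t) := by
  induction t with
  | zero => exact hw.measurable_init i
  | succ t ih =>
    have h3 : G i (t + 1) = fun ω => reflect (G i t ω + X i t ω) := funext (hw.step i t)
    rw [h3]
    exact continuous_reflect.measurable.comp (ih.add (hw.measurable_incr i t))

lemma indepFun_of_disjoint {S S' : Set (ℕ ⊕ ℕ × ℕ)} (hS : Disjoint S S') {Y Z : Ω → ℝ}
    (hY : Measurable[noiseSigma G X S] Y) (hZ : Measurable[noiseSigma G X S'] Z) :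
    IndepFun Y Z μ := by
  have h := indep_iSup_of_disjoint (fun k => ?_) hw.indep.iIndep hS
  · exact indep_of_indep_of_le_left (indep_of_indep_of_le_right h hZ.comap_le) hY.comap_le
  · rcases k with i | p
    · exact (hw.measurable_init i).comap_le
    · exact (hw.measurable_incr p.1 p.2).comap_le

lemma indepFun_past_incr {i t : ℕ} {Y : Ω → ℝ}
    (hY : Measurable[noiseSigma G X (pastIndices i t)] Y) : IndepFun Y (X i t) μ := by
  refine hw.indepFun_of_disjoint (S' := {Sum.inr (i, t)}) ?_ hY (measurable_incr_of_mem rfl)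
  rw [Set.disjoint_singleton_right]
  rintro ⟨-, h⟩
  exact lt_irrefl _ h

lemma indepFun_gain {i j : ℕ} (hij : i ≠ j) (t : ℕ) : IndepFun (G i t) (G j t) μ := by
  refine hw.indepFun_of_disjoint ?_ (hw.measurable_gain_past i t) (hw.measurable_gain_past j t)
  rw [Set.disjoint_left]
  rintro (k | p) h1 h2
  · exact hij (h1.symm.trans h2)
  · exact hij (h1.1.symm.trans h2.1)

variable [IsProbabilityMeasure μ]

lemma map_gain (i t : ℕ) : μ.map (G i t) = volume.restrict (Set.Icc (0 : ℝ) 1) := by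
  induction t with
  | zero => exact hw.init_law i
  | succ t ih =>
    have hind := hw.indepFun_past_incr (hw.measurable_gain_past i t)
    rw [indepFun_iff_map_prod_eq_prod_map_map (hw.measurable_gain i t).aemeasurable
      (hw.measurable_incr i t).aemeasurable, ih, hw.incr_law] at hind
    have h3 : G i (t + 1) = (fun p : ℝ × ℝ => reflect (p.1 + p.2)) ∘
        fun ω => (G i t ω, X i t ω) := funext (hw.step i t)
    have h4 : Measurable fun p : ℝ × ℝ => reflect (p.1 + p.2) :=
      continuous_reflect.measurable.comp (by fun_prop)
    rw [h3, ← Measure.map_map h4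
      ((hw.measurable_gain i t).prodMk (hw.measurable_incr i t)), hind,
      map_reflect_add_gaussianReal]

lemma ae_gain_mem (i t : ℕ) : ∀ᵐ ω ∂μ, G i t ω ∈ Set.Icc (0 : ℝ) 1 := by
  have h : ∀ᵐ x ∂(μ.map (G i t)), x ∈ Set.Icc (0 : ℝ) 1 := by
    rw [hw.map_gain]
    exact ae_restrict_mem measurableSet_Icc
  exact ae_of_ae_map (hw.measurable_gain i t).aemeasurable h

end IsReflectedWalk

/-- The displacement, after `n` steps from time `s`, of the walk unfolded to the real line. -/
noncomputable def unfolded (G X : ℕ → ℕ → Ω → ℝ) (i s : ℕ) : ℕ → Ω → ℝ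
  | 0, _ => 0
  | n + 1, ω => unfolded G X i s n ω +
      foldSign (G i s ω + unfolded G X i s n ω) * X i (s + n) ω

lemma lintegral_exp_gaussian {Y : Ω → ℝ} (hY : Measurable Y) {v : NNReal}
    (hlaw : μ.map Y = gaussianReal 0 v) (θ : ℝ) :
    ∫⁻ ω, ENNReal.ofReal (Real.exp (θ * Y ω)) ∂μ = ENNReal.ofReal (Real.exp (v * θ ^ 2 / 2)) := by
  have hm := mgf_gaussianReal hlaw θ
  have hint : Integrable (fun ω => Real.exp (θ * Y ω)) μ := by
    have := integrable_exp_mul_gaussianReal (μ := 0) (v := v) θ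
    rw [← hlaw] at this
    exact this.comp_measurable hY
  rw [← ofReal_integral_eq_lintegral_ofReal hint (ae_of_all _ fun _ => (Real.exp_pos _).le)]
  rw [mgf] at hm
  rw [hm]
  simp

namespace IsReflectedWalk

variable (hw : IsReflectedWalk μ σ G X)
include hw

lemma measurable_unfolded (i s n : ℕ) :
    Measurable[noiseSigma G X (pastIndices i (s + n))] (unfolded G X i s n) := by
  induction n with
  | zero => exact measurable_const
  | succ n ih =>
    have h0 : Measurable[noiseSigma G X (pastIndices i (s + (n + 1)))] (G i s) :=
      (hw.measurable_gain_past i s).mono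
        (noiseSigma_mono (pastIndices_mono i (Nat.le_add_right _ _))) le_rfl
    have h1 : Measurable[noiseSigma G X (pastIndices i (s + (n + 1)))] (unfolded G X i s n) :=
      ih.mono (noiseSigma_mono (pastIndices_mono i (Nat.le_succ _))) le_rfl
    have h2 : Measurable[noiseSigma G X (pastIndices i (s + (n + 1)))] (X i (s + n)) :=
      measurable_incr_of_mem ⟨rfl, Nat.lt_succ_self _⟩
    exact h1.add ((measurable_foldSign.comp (h0.add h1)).mul h2)

lemma noiseSigma_le (S : Set (ℕ ⊕ ℕ × ℕ)) : noiseSigma G X S ≤ mΩ := by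
  refine iSup₂_le fun k _ => ?_
  rcases k with i | p
  · exact (hw.measurable_init i).comap_le
  · exact (hw.measurable_incr p.1 p.2).comap_le

lemma reflect_add_unfolded {i s : ℕ} {ω : Ω} (h : G i s ω ∈ Set.Icc (0 : ℝ) 1) (n : ℕ) :
    G i (s + n) ω = reflect (G i s ω + unfolded G X i s n ω) := by
  induction n with
  | zero => simp [unfolded, reflect_of_mem_Icc h]
  | succ n ih =>
    rw [← add_assoc, hw.step, ih, reflect_reflect_add]
    simp only [unfolded, add_assoc]

/-- Both gains are reflections of points at distance `|unfolded G X i s n ω|`, the starting gain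
being fixed by `reflect`, which is 1-Lipschitz. -/
lemma abs_gain_sub_le {i s : ℕ} {ω : Ω} (h : G i s ω ∈ Set.Icc (0 : ℝ) 1) (n : ℕ) :
    |G i (s + n) ω - G i s ω| ≤ |unfolded G X i s n ω| := by
  have h2 : G i s ω = reflect (G i s ω) := (reflect_of_mem_Icc h).symm
  rw [hw.reflect_add_unfolded h n]
  conv_lhs => rw [h2, ← h2]
  calc |reflect (G i s ω + unfolded G X i s n ω) - G i s ω|
      = |reflect (G i s ω + unfolded G X i s n ω) - reflect (G i s ω)| := by rw [← h2]
    _ ≤ _ := by simpa using abs_reflect_sub_le (G i s ω + unfolded G X i s n ω) (G i s ω)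

/-- The displacement of the unfolded walk has Gaussian exponential moments. -/
lemma lintegral_exp_unfolded [IsProbabilityMeasure μ] (i s n : ℕ) (θ : ℝ) :
    ∫⁻ ω, ENNReal.ofReal (Real.exp (θ * unfolded G X i s n ω)) ∂μ =
      ENNReal.ofReal (Real.exp (n * (σ ^ 2 * θ ^ 2 / 2))) := by
  induction n with
  | zero => simp [unfolded]
  | succ n ih =>
    set D := unfolded G X i s n with hD
    -- The sign of the next step is decided by the past. On `E` the step is `X` and off `E` it is
    -- `-X`; both are independent of the past with the same exponential moment, which therefore
    -- factors out.
    set E : Set Ω := {ω | foldSign (G i s ω + D ω) = 1} with hE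
    have hm : noiseSigma G X (pastIndices i (s + n)) ≤ mΩ := hw.noiseSigma_le _
    have hDm := hw.measurable_unfolded i s n
    have hG : Measurable[noiseSigma G X (pastIndices i (s + n))] (G i s) :=
      (hw.measurable_gain_past i s).mono
        (noiseSigma_mono (pastIndices_mono i (Nat.le_add_right _ _))) le_rfl
    have hEm : MeasurableSet[noiseSigma G X (pastIndices i (s + n))] E :=
      (measurable_foldSign.comp (hG.add hDm)) (measurableSet_singleton (1 : ℝ))
    have hXm : Measurable (X i (s + n)) := hw.measurable_incr _ _
    have hgauss : ∀ θ : ℝ, ∫⁻ ω, ENNReal.ofReal (Real.exp (θ * X i (s + n) ω)) ∂μ =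
        ENNReal.ofReal (Real.exp (σ ^ 2 * θ ^ 2 / 2)) := fun θ => by
      rw [lintegral_exp_gaussian hXm (hw.incr_law i (s + n)), Real.coe_toNNReal _ (sq_nonneg σ)]
    set f : Ω → ENNReal := fun ω => ENNReal.ofReal (Real.exp (θ * D ω)) with hf
    have hfm : Measurable[noiseSigma G X (pastIndices i (s + n))] f :=
      ENNReal.measurable_ofReal.comp (Real.measurable_exp.comp (hDm.const_mul θ))
    have hXsig : ∀ θ : ℝ, Measurable[noiseSigma G X {Sum.inr (i, s + n)}]
        fun ω => ENNReal.ofReal (Real.exp (θ * X i (s + n) ω)) := fun θ =>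
      ENNReal.measurable_ofReal.comp (Real.measurable_exp.comp
        ((measurable_incr_of_mem (S := {Sum.inr (i, s + n)}) rfl).const_mul θ))
    have hindep : Indep (noiseSigma G X (pastIndices i (s + n)))
        (noiseSigma G X {Sum.inr (i, s + n)}) μ := by
      refine indep_iSup_of_disjoint (fun k => ?_) hw.indep.iIndep ?_
      · rcases k with i | p
        · exact (hw.measurable_init i).comap_le
        · exact (hw.measurable_incr p.1 p.2).comap_le
      · rw [Set.disjoint_singleton_right]
        rintro ⟨-, h⟩
        exact lt_irrefl _ h
    have hprod : ∀ θ' : ℝ, θ' ^ 2 = θ ^ 2 → ∀ A : Set Ω,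
        MeasurableSet[noiseSigma G X (pastIndices i (s + n))] A →
        ∫⁻ ω, A.indicator f ω * ENNReal.ofReal (Real.exp (θ' * X i (s + n) ω)) ∂μ =
          (∫⁻ ω, A.indicator f ω ∂μ) * ENNReal.ofReal (Real.exp (σ ^ 2 * θ ^ 2 / 2)) := by
      intro θ' hθ' A hA
      rw [lintegral_mul_eq_lintegral_mul_lintegral_of_independent_measurableSpace hm
        (hw.noiseSigma_le _) hindep (hfm.indicator hA) (hXsig θ'), hgauss, hθ']
    have hsplit : ∀ ω, ENNReal.ofReal (Real.exp (θ * unfolded G X i s (n + 1) ω)) =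
        E.indicator f ω * ENNReal.ofReal (Real.exp (θ * X i (s + n) ω)) +
        Eᶜ.indicator f ω * ENNReal.ofReal (Real.exp (-θ * X i (s + n) ω)) := by
      intro ω
      have hun : unfolded G X i s (n + 1) ω =
        D ω + foldSign (G i s ω + D ω) * X i (s + n) ω := rfl
      by_cases hω : ω ∈ E
      · have h1 : foldSign (G i s ω + D ω) = 1 := hω
        rw [hun, h1]
        simp only [hω, Set.indicator_of_mem, Set.mem_compl_iff, not_true, not_false_eq_true,
          Set.indicator_of_notMem, zero_mul, add_zero, hf]
        rw [← ENNReal.ofReal_mul (Real.exp_pos _).le, ← Real.exp_add]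
        congr 2
        ring
      · have h1 : foldSign (G i s ω + D ω) = -1 := (foldSign_eq_or _).resolve_left hω
        rw [hun, h1]
        simp only [hω, Set.indicator_of_mem, Set.mem_compl_iff, not_false_eq_true,
          Set.indicator_of_notMem, zero_mul, zero_add, hf]
        rw [← ENNReal.ofReal_mul (Real.exp_pos _).le, ← Real.exp_add]
        congr 2
        ring
    have hfm' : Measurable f := hfm.mono hm le_rfl
    have hEm' : MeasurableSet E := hm _ hEm
    have hexpm : ∀ θ : ℝ, Measurable fun ω => ENNReal.ofReal (Real.exp (θ * X i (s + n) ω)) :=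
      fun θ => (hXsig θ).mono (hw.noiseSigma_le _) le_rfl
    simp_rw [hsplit]
    rw [lintegral_add_left (by exact (hfm'.indicator hEm').mul (hexpm θ)), hprod θ rfl E hEm,
      hprod (-θ) (neg_sq θ) Eᶜ hEm.compl, ← add_mul, lintegral_indicator hEm',
      lintegral_indicator hEm'.compl, lintegral_add_compl f hEm', ih,
      ← ENNReal.ofReal_mul (Real.exp_pos _).le, ← Real.exp_add]
    congr 2
    push_cast
    ring

/-- Gaussian concentration of the displacement over `n` steps. -/
lemma measure_displacement_le [IsProbabilityMeasure μ] (hσ : 0 < σ) {β : ℝ} (hβ : 0 < β) (i s : ℕ)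
    {n : ℕ} (hn : 0 < n) :
    μ {ω | β * √n < |G i (s + n) ω - G i s ω|} ≤
      ENNReal.ofReal (2 * Real.exp (-(β ^ 2 / (2 * σ ^ 2)))) := by
  have hn' : (0 : ℝ) < n := by exact_mod_cast hn
  have hsq : √(n : ℝ) * √n = n := Real.mul_self_sqrt hn'.le
  have hr : 0 < √(n : ℝ) := Real.sqrt_pos.2 hn'
  -- Chernoff bound at the optimal `θ = ±β / (σ² √n)`: the log-moment is `β² / (2σ²)` against the
  -- threshold `β² / σ²`, so `n` drops out. The two signs give the two tails.
  have htail : ∀ θ : ℝ, θ ^ 2 = (β / (σ ^ 2 * √n)) ^ 2 →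
      μ {ω | β ^ 2 / σ ^ 2 ≤ θ * unfolded G X i s n ω} ≤
        ENNReal.ofReal (Real.exp (-(β ^ 2 / (2 * σ ^ 2)))) := by
    intro θ hθ
    have hmeas : Measurable fun ω => ENNReal.ofReal (Real.exp (θ * unfolded G X i s n ω)) :=
      ENNReal.measurable_ofReal.comp (Real.measurable_exp.comp
        (((hw.measurable_unfolded i s n).mono (hw.noiseSigma_le _) le_rfl).const_mul θ))
    have hmarkov := mul_meas_ge_le_lintegral₀ (μ := μ) hmeas.aemeasurable
      (ENNReal.ofReal (Real.exp (β ^ 2 / σ ^ 2)))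
    rw [hw.lintegral_exp_unfolded] at hmarkov
    have hset : {ω | β ^ 2 / σ ^ 2 ≤ θ * unfolded G X i s n ω} ⊆
        {ω | ENNReal.ofReal (Real.exp (β ^ 2 / σ ^ 2)) ≤
          ENNReal.ofReal (Real.exp (θ * unfolded G X i s n ω))} := fun ω hω =>
      ENNReal.ofReal_le_ofReal (Real.exp_le_exp.2 hω)
    have hexp : Real.exp (n * (σ ^ 2 * θ ^ 2 / 2)) =
        Real.exp (β ^ 2 / σ ^ 2) * Real.exp (-(β ^ 2 / (2 * σ ^ 2))) := by
      rw [← Real.exp_add, hθ, div_pow, mul_pow, sq (√(n : ℝ)), hsq]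
      congr 1
      field_simp
      ring
    rw [hexp, ENNReal.ofReal_mul (Real.exp_pos _).le] at hmarkov
    refine (measure_mono hset).trans ?_
    rwa [ENNReal.mul_le_mul_iff_right] at hmarkov
    · simpa using Real.exp_pos _
    · exact ENNReal.ofReal_ne_top
  have hsub : {ω | β * √n < |G i (s + n) ω - G i s ω|} ≤ᵐ[μ]
      ({ω | β ^ 2 / σ ^ 2 ≤ β / (σ ^ 2 * √n) * unfolded G X i s n ω} ∪
        {ω | β ^ 2 / σ ^ 2 ≤ -(β / (σ ^ 2 * √n)) * unfolded G X i s n ω} : Set Ω) := by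
    filter_upwards [hw.ae_gain_mem i s] with ω hω hdev
    have habs : β * √n < |unfolded G X i s n ω| :=
      lt_of_lt_of_le hdev (hw.abs_gain_sub_le hω n)
    have hβσ : β ^ 2 / σ ^ 2 = β / (σ ^ 2 * √n) * (β * √n) := by field_simp
    have hpos : 0 ≤ β / (σ ^ 2 * √n) := by positivity
    rcases lt_abs.1 habs with h | h
    · left
      rw [Set.mem_ofPred_eq, hβσ]
      exact mul_le_mul_of_nonneg_left h.le hpos
    · right
      rw [Set.mem_ofPred_eq, hβσ, neg_mul_comm]
      exact mul_le_mul_of_nonneg_left h.le hpos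
  refine (measure_mono_ae hsub).trans ((measure_union_le _ _).trans ?_)
  rw [two_mul, ENNReal.ofReal_add (Real.exp_pos _).le (Real.exp_pos _).le]
  exact add_le_add (htail _ rfl) (htail _ (neg_sq _))

/-- A reflected walk is unlikely to deviate: only the last `1 / β ^ 2` times matter, since gains lie
in `[0, 1]`. -/
lemma measure_deviates_le [IsProbabilityMeasure μ] (hσ : 0 < σ) {β : ℝ} (hβ : 0 < β) (i t : ℕ) :
    μ {ω | Deviates β (fun s => G i s ω) t} ≤
      ENNReal.ofReal (1 / β ^ 2 * (2 * Real.exp (-(β ^ 2 / (2 * σ ^ 2))))) := by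
  set S := (Finset.Icc 1 ⌊1 / β ^ 2⌋₊).filter fun n => n ≤ t with hS
  have hsub : {ω | Deviates β (fun s => G i s ω) t} ≤ᵐ[μ]
      (⋃ n ∈ S, {ω | β * √n < |G i (t - n + n) ω - G i (t - n) ω|} : Set Ω) := by
    filter_upwards [ae_all_iff.2 (hw.ae_gain_mem i)] with ω hω hdev
    obtain ⟨s, hs, hlt⟩ := hdev
    change ω ∈ ⋃ n ∈ S, {ω | β * √n < |G i (t - n + n) ω - G i (t - n) ω|}
    rw [← Nat.cast_sub hs.le] at hlt
    have hone : |G i t ω - G i s ω| ≤ 1 := by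
      have h1 := hω t
      have h2 := hω s
      rw [abs_le]
      constructor <;> linarith [h1.1, h1.2, h2.1, h2.2]
    have hb : β * √((t - s : ℕ) : ℝ) < 1 := hlt.trans_le hone
    have hb2 : β ^ 2 * ((t - s : ℕ) : ℝ) ≤ 1 := by
      have h0 : 0 ≤ β * √((t - s : ℕ) : ℝ) := by positivity
      have := mul_le_one₀ hb.le h0 hb.le
      calc β ^ 2 * ((t - s : ℕ) : ℝ)
          = β ^ 2 * (√((t - s : ℕ) : ℝ) * √((t - s : ℕ) : ℝ)) := by
            rw [Real.mul_self_sqrt (Nat.cast_nonneg _)]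
        _ = β * √((t - s : ℕ) : ℝ) * (β * √((t - s : ℕ) : ℝ)) := by ring
        _ ≤ 1 := this
    rw [Set.mem_iUnion₂]
    refine ⟨t - s, ?_, ?_⟩
    · rw [hS, Finset.mem_filter, Finset.mem_Icc]
      refine ⟨⟨by omega, Nat.le_floor ?_⟩, by omega⟩
      rw [le_div_iff₀ (by positivity)]
      linarith
    · have e1 : t - (t - s) = s := by omega
      have e2 : s + (t - s) = t := by omega
      rw [Set.mem_ofPred_eq, e1, e2]
      exact hlt
  refine (measure_mono_ae hsub).trans ((measure_biUnion_finset_le _ _).trans ?_)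
  calc ∑ n ∈ S, μ {ω | β * √n < |G i (t - n + n) ω - G i (t - n) ω|}
      ≤ ∑ n ∈ S, ENNReal.ofReal (2 * Real.exp (-(β ^ 2 / (2 * σ ^ 2)))) := by
        refine Finset.sum_le_sum fun n hn => hw.measure_displacement_le hσ hβ i _ ?_
        exact (Finset.mem_Icc.1 (Finset.mem_filter.1 hn).1).1
    _ = ENNReal.ofReal (S.card * (2 * Real.exp (-(β ^ 2 / (2 * σ ^ 2))))) := by
        rw [Finset.sum_const, nsmul_eq_mul, ENNReal.ofReal_mul (Nat.cast_nonneg _),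
          ENNReal.ofReal_natCast]
    _ ≤ _ := by
        refine ENNReal.ofReal_le_ofReal (mul_le_mul_of_nonneg_right ?_ (by positivity))
        have h1 : S.card ≤ ⌊1 / β ^ 2⌋₊ :=
          (Finset.card_filter_le _ _).trans (by simp)
        exact (Nat.cast_le.2 h1).trans (Nat.floor_le (by positivity))

end IsReflectedWalk

end Walk

/-! ### Mean gap charge of two independent uniform gains -/

section Gap

lemma integral_inv_add_abs_sub {b y : ℝ} (hb : 0 < b) (hy : y ∈ Set.Icc (0 : ℝ) 1) :
    ∫ u in (0 : ℝ)..1, (b + |u - y|)⁻¹ = Real.log ((b + y) / b) + Real.log ((b + 1 - y) / b) := by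
  have hint : ∀ p q, IntervalIntegrable (fun u => (b + |u - y|)⁻¹) volume p q := fun p q =>
    (Continuous.inv₀ (by fun_prop) fun u => by positivity).intervalIntegrable _ _
  rw [← intervalIntegral.integral_add_adjacent_intervals (hint 0 y) (hint y 1)]
  congr 1
  · have h1 : ∫ u in (0 : ℝ)..y, (b + |u - y|)⁻¹ = ∫ u in (0 : ℝ)..y, ((b + y) - u)⁻¹ := by
      refine intervalIntegral.integral_congr fun u hu => ?_
      rw [Set.uIcc_of_le hy.1] at hu
      simp only [abs_of_nonpos (sub_nonpos.2 hu.2)]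
      congr 1
      ring
    rw [h1, intervalIntegral.integral_comp_sub_left (fun x => x⁻¹),
      integral_inv_of_pos (by linarith) (by linarith [hy.1])]
    congr 2 <;> ring
  · have h1 : ∫ u in y..1, (b + |u - y|)⁻¹ = ∫ u in y..1, (u - (y - b))⁻¹ := by
      refine intervalIntegral.integral_congr fun u hu => ?_
      rw [Set.uIcc_of_le hy.2] at hu
      simp only [abs_of_nonneg (sub_nonneg.2 hu.1)]
      congr 1
      ring
    rw [h1, intervalIntegral.integral_comp_sub_right (fun x => x⁻¹),
      integral_inv_of_pos (by linarith) (by linarith [hy.2])]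
    congr 2 <;> ring

lemma integral_inv_add_abs_sub_le {b y : ℝ} (hb : 0 < b) (hy : y ∈ Set.Icc (0 : ℝ) 1) :
    ∫ u in (0 : ℝ)..1, (b + |u - y|)⁻¹ ≤ 2 * Real.log (1 + 1 / b) := by
  rw [integral_inv_add_abs_sub hb hy]
  have e : 1 + 1 / b = (b + 1) / b := by field_simp
  have h1 : Real.log ((b + y) / b) ≤ Real.log ((b + 1) / b) :=
    Real.log_le_log (div_pos (by linarith [hy.1]) hb) (by gcongr; exact hy.2)
  have h2 : Real.log ((b + 1 - y) / b) ≤ Real.log ((b + 1) / b) :=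
    Real.log_le_log (div_pos (by linarith [hy.2]) hb) (by gcongr; linarith [hy.1])
  rw [e]
  linarith

lemma gapCharge_eq (β d : ℝ) : gapCharge β d = 16 * β ^ 2 * (4 * β + |d|)⁻¹ := by
  unfold gapCharge
  ring

lemma continuous_gapCharge {β : ℝ} (hβ : 0 < β) : Continuous (gapCharge β) := by
  have : gapCharge β = fun d => 16 * β ^ 2 * (4 * β + |d|)⁻¹ := funext (gapCharge_eq β)
  rw [this]
  exact continuous_const.mul (Continuous.inv₀ (by fun_prop) fun u => by positivity)

/-- With one gain fixed at `y`, the integrand is `16β² / (4β + |u - y|)`. The shift `4β` cuts off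
the singularity at `u = y` and leaves only a logarithm, uniformly in `y`. -/
lemma lintegral_gapCharge_le {β : ℝ} (hβ : 0 < β) :
    ∫⁻ p, ENNReal.ofReal (gapCharge β (p.1 - p.2))
      ∂((volume.restrict (Set.Icc (0 : ℝ) 1)).prod (volume.restrict (Set.Icc (0 : ℝ) 1))) ≤
      ENNReal.ofReal (32 * β ^ 2 * Real.log (1 + 1 / (4 * β))) := by
  set U := volume.restrict (Set.Icc (0 : ℝ) 1) with hU
  have : IsProbabilityMeasure U := ⟨by simp [hU]⟩
  have hm : Measurable fun p : ℝ × ℝ => ENNReal.ofReal (gapCharge β (p.1 - p.2)) :=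
    ENNReal.measurable_ofReal.comp ((continuous_gapCharge hβ).measurable.comp (by fun_prop))
  rw [lintegral_prod_symm' _ hm]
  have hle : ∀ᵐ y ∂U, ∫⁻ u, ENNReal.ofReal (gapCharge β (u - y)) ∂U ≤
      ENNReal.ofReal (32 * β ^ 2 * Real.log (1 + 1 / (4 * β))) := by
    filter_upwards [ae_restrict_mem measurableSet_Icc] with y hy
    have hc : Continuous fun u => gapCharge β (u - y) :=
      (continuous_gapCharge hβ).comp (by fun_prop)
    have hi : Integrable (fun u => gapCharge β (u - y)) U :=
      hc.continuousOn.integrableOn_compact isCompact_Icc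
    rw [← ofReal_integral_eq_lintegral_ofReal hi (ae_of_all _ fun _ => gapCharge_nonneg hβ _)]
    refine ENNReal.ofReal_le_ofReal ?_
    rw [hU, integral_Icc_eq_integral_Ioc, ← intervalIntegral.integral_of_le zero_le_one]
    simp only [gapCharge_eq]
    rw [intervalIntegral.integral_const_mul]
    have := integral_inv_add_abs_sub_le (b := 4 * β) (by positivity) hy
    nlinarith [sq_nonneg β]
  calc _ ≤ ∫⁻ _, ENNReal.ofReal (32 * β ^ 2 * Real.log (1 + 1 / (4 * β))) ∂U :=
        lintegral_mono_ae hle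
    _ = _ := by simp

end Gap

/-! ### Expected charges for random candidate sets -/

/-- What the ordered pair `p` of candidates contributes in slot `t` to the pathwise bound on the
regret. -/
noncomputable def pairCharge (β : ℝ) (t : ℕ) (p : ℕ × ℕ) (g : ℕ → ℕ → ℝ) : ℝ :=
  gapCharge β (g p.1 t - g p.2 t) + (deviation β (g p.1) t + deviation β (g p.2) t)

lemma pairCharge_nonneg {β : ℝ} (hβ : 0 < β) (t : ℕ) (p : ℕ × ℕ) (g : ℕ → ℕ → ℝ) :
    0 ≤ pairCharge β t p g :=
  add_nonneg (gapCharge_nonneg hβ _) (add_nonneg (deviation_nonneg _ _ _) (deviation_nonneg _ _ _))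

lemma measurableSet_deviates (β : ℝ) (t : ℕ) : MeasurableSet {x : ℕ → ℝ | Deviates β x t} := by
  have : {x : ℕ → ℝ | Deviates β x t} =
      ⋃ s ∈ Finset.range t, {x | β * √((t : ℝ) - s) < |x t - x s|} := by
    ext x
    simp [Deviates]
  rw [this]
  refine Finset.measurableSet_biUnion _ fun s _ => measurableSet_lt measurable_const ?_
  exact (continuous_abs.comp ((continuous_apply t).sub (continuous_apply s))).measurable

lemma measurable_deviation (β : ℝ) (t : ℕ) : Measurable fun x => deviation β x t := by
  unfold deviation
  exact Measurable.ite (measurableSet_deviates β t) measurable_const measurable_const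

lemma measurable_pairCharge {β : ℝ} (hβ : 0 < β) (t : ℕ) (p : ℕ × ℕ) :
    Measurable (pairCharge β t p) := by
  have h : ∀ i, Measurable fun g : ℕ → ℕ → ℝ => g i := measurable_pi_apply
  have h' : ∀ i, Measurable fun g : ℕ → ℕ → ℝ => g i t := fun i =>
    (measurable_pi_apply t).comp (h i)
  exact ((continuous_gapCharge hβ).measurable.comp ((h' _).sub (h' _))).add
    (((measurable_deviation β t).comp (h _)).add ((measurable_deviation β t).comp (h _)))

section Charge

variable {Ω : Type u} [mΩ : MeasurableSpace Ω] {μ : Measure Ω} {σ : ℝ}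
  {G X : ℕ → ℕ → Ω → ℝ} {V : ℕ → Ω → Finset ℕ} {T : ℕ}

lemma IsReflectedWalk.measurable_gains (hw : IsReflectedWalk μ σ G X) :
    Measurable fun ω (i t : ℕ) => G i t ω :=
  measurable_pi_lambda _ fun i => measurable_pi_lambda _ fun t => hw.measurable_gain i t

lemma lintegral_deviation_le [IsProbabilityMeasure μ] (hw : IsReflectedWalk μ σ G X)
    (hσ : 0 < σ) {β : ℝ} (hβ : 0 < β) (i t : ℕ) :
    ∫⁻ ω, ENNReal.ofReal (deviation β (fun s => G i s ω) t) ∂μ ≤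
      ENNReal.ofReal (1 / β ^ 2 * (2 * Real.exp (-(β ^ 2 / (2 * σ ^ 2))))) := by
  refine le_trans (le_of_eq ?_) (hw.measure_deviates_le hσ hβ i t)
  have hm : MeasurableSet {ω | Deviates β (fun s => G i s ω) t} :=
    (measurable_pi_lambda _ fun s => hw.measurable_gain i s) (measurableSet_deviates β t)
  rw [← lintegral_indicator_one hm]
  refine lintegral_congr fun ω => ?_
  by_cases h : Deviates β (fun s => G i s ω) t <;> simp [deviation, h, Set.indicator]

lemma lintegral_pairCharge_le [IsProbabilityMeasure μ] (hw : IsReflectedWalk μ σ G X)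
    (hσ : 0 < σ) {β : ℝ} (hβ : 0 < β) {p : ℕ × ℕ} (hp : p.1 ≠ p.2) (t : ℕ) :
    ∫⁻ ω, ENNReal.ofReal (pairCharge β t p fun i s => G i s ω) ∂μ ≤
      ENNReal.ofReal (32 * β ^ 2 * Real.log (1 + 1 / (4 * β)) +
        2 * (1 / β ^ 2 * (2 * Real.exp (-(β ^ 2 / (2 * σ ^ 2)))))) := by
  have hind := hw.indepFun_gain hp t
  rw [indepFun_iff_map_prod_eq_prod_map_map (hw.measurable_gain _ t).aemeasurable
      (hw.measurable_gain _ t).aemeasurable, hw.map_gain, hw.map_gain] at hind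
  have hgm : Measurable fun q : ℝ × ℝ => ENNReal.ofReal (gapCharge β (q.1 - q.2)) :=
    ENNReal.measurable_ofReal.comp ((continuous_gapCharge hβ).measurable.comp (by fun_prop))
  have hgap : ∫⁻ ω, ENNReal.ofReal (gapCharge β (G p.1 t ω - G p.2 t ω)) ∂μ ≤
      ENNReal.ofReal (32 * β ^ 2 * Real.log (1 + 1 / (4 * β))) := by
    have h := lintegral_gapCharge_le hβ
    rwa [← hind, lintegral_map hgm
      ((hw.measurable_gain _ t).prodMk (hw.measurable_gain _ t))] at h
  have hlog : 0 ≤ Real.log (1 + 1 / (4 * β)) :=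
    Real.log_nonneg (by have : 0 < 1 / (4 * β) := by positivity
                        linarith)
  have hdm : ∀ i, Measurable fun ω => deviation β (fun s => G i s ω) t := fun i =>
    (measurable_deviation β t).comp (measurable_pi_lambda _ fun s => hw.measurable_gain i s)
  simp only [pairCharge]
  simp_rw [ENNReal.ofReal_add (gapCharge_nonneg hβ _)
    (add_nonneg (deviation_nonneg _ _ _) (deviation_nonneg _ _ _)),
    ENNReal.ofReal_add (deviation_nonneg _ _ _) (deviation_nonneg _ _ _)]
  rw [lintegral_add_right _ (by exact (hdm _).ennreal_ofReal.add (hdm _).ennreal_ofReal),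
    lintegral_add_right _ (hdm _).ennreal_ofReal,
    ENNReal.ofReal_add (by positivity) (by positivity), two_mul (1 / β ^ 2 * _),
    ENNReal.ofReal_add (by positivity) (by positivity)]
  exact add_le_add hgap (add_le_add (lintegral_deviation_le hw hσ hβ _ t)
    (lintegral_deviation_le hw hσ hβ _ t))

namespace IsCandidateProcess

variable (hc : IsCandidateProcess μ T G V)
include hc

lemma measurableSet_mem_offDiag (t : ℕ) (p : ℕ × ℕ) :
    MeasurableSet {ω | p ∈ (V t ω).offDiag} := by
  have : {ω | p ∈ (V t ω).offDiag} =
      {ω | p.1 ∈ V t ω} ∩ {ω | p.2 ∈ V t ω} ∩ {_ω | p.1 ≠ p.2} := by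
    ext ω
    simp [Finset.mem_offDiag, and_assoc]
  rw [this]
  exact ((hc.measurable t _).inter (hc.measurable t _)).inter (MeasurableSet.const _)

/-- The candidate sets being independent of the gains, the expected charge of a slot is at most
twice the expected charge of a fixed pair. -/
lemma lintegral_tsum_charge_le [IsProbabilityMeasure μ] {t : ℕ} (ht : t ∈ Finset.Icc 1 T)
    {c : ℕ × ℕ → (ℕ → ℕ → ℝ) → ENNReal} (hcm : ∀ p, Measurable (c p))
    (hG : Measurable fun ω (i t : ℕ) => G i t ω) {κ : ENNReal}
    (hκ : ∀ p : ℕ × ℕ, p.1 ≠ p.2 → ∫⁻ ω, c p (fun i s => G i s ω) ∂μ ≤ κ) :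
    ∫⁻ ω, ∑' p, {ω | p ∈ (V t ω).offDiag}.indicator 1 ω * c p (fun i s => G i s ω) ∂μ ≤
      2 * κ := by
  have hm : ∀ p, Measurable ({ω | p ∈ (V t ω).offDiag}.indicator (1 : Ω → ENNReal)) := fun p =>
    measurable_one.indicator (hc.measurableSet_mem_offDiag t p)
  have hprod : ∀ p, ∫⁻ ω, {ω | p ∈ (V t ω).offDiag}.indicator 1 ω *
      c p (fun i s => G i s ω) ∂μ ≤
      (∫⁻ ω, {ω | p ∈ (V t ω).offDiag}.indicator 1 ω ∂μ) * κ := by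
    intro p
    by_cases hp : p.1 = p.2
    · simp [Finset.mem_offDiag, hp]
    set S : Set (ℕ → ℕ → Prop) := {v | v t p.1} ∩ {v | v t p.2} with hS
    have hSm : MeasurableSet S := by
      have h1 : ∀ i, Measurable fun v : ℕ → ℕ → Prop => v t i := fun i =>
        (measurable_pi_apply i).comp (measurable_pi_apply t)
      exact (measurableSet_setOfPred.2 (h1 _)).inter (measurableSet_setOfPred.2 (h1 _))
    have hVm : Measurable (S.indicator (1 : (ℕ → ℕ → Prop) → ENNReal)) :=
      measurable_one.indicator hSm
    have hind := hc.indep.comp hVm (hcm p)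
    -- Writing the indicator as a function of the candidate process alone lets independence from the
    -- gains split the expectation.
    have heq : {ω | p ∈ (V t ω).offDiag}.indicator (1 : Ω → ENNReal) =
        S.indicator (1 : (ℕ → ℕ → Prop) → ENNReal) ∘ fun ω (t i : ℕ) => i ∈ V t ω := by
      ext ω
      simp [Set.indicator, hS, Finset.mem_offDiag, hp]
    have := lintegral_mul_eq_lintegral_mul_lintegral_of_indepFun
      (by rw [← heq]; exact hm p) ((hcm p).comp hG) hind
    rw [← heq] at this
    exact this.le.trans (mul_le_mul_right (hκ p hp) _)
  rw [lintegral_tsum fun p => by exact ((hm p).mul ((hcm p).comp hG)).aemeasurable]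
  calc _ ≤ ∑' p, (∫⁻ ω, {ω | p ∈ (V t ω).offDiag}.indicator 1 ω ∂μ) * κ :=
        ENNReal.tsum_le_tsum hprod
    _ = (∫⁻ ω, ∑' p, {ω | p ∈ (V t ω).offDiag}.indicator 1 ω ∂μ) * κ := by
        rw [ENNReal.tsum_mul_right, lintegral_tsum fun p => (hm p).aemeasurable]
    _ ≤ (∫⁻ _, 2 ∂μ) * κ := by
        refine mul_le_mul_left (lintegral_mono fun ω => ?_) _
        rw [tsum_eq_sum (s := (V t ω).offDiag) fun p hp => by simpa using hp,
          Finset.sum_congr rfl fun p hp => Set.indicator_of_mem (by exact hp) 1]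
        have h2 := hc.card_le_two t ht ω
        -- At most two candidates form at most two ordered pairs; this is the factor 2 in front of
        -- `κ`.
        have h3 : (V t ω).offDiag.card ≤ 2 := by
          rw [Finset.offDiag_card]
          interval_cases (V t ω).card <;> simp
        simpa using (Nat.cast_le (α := ENNReal)).2 h3
    _ = 2 * κ := by simp

/-- There are only countably many finite sets of vehicles, so the membership events make each `V t`
a discrete random variable, and any function of two of them is measurable. -/
lemma measurable_arrivals : Measurable fun ω => (arrivals T (fun t => V t ω) : ℝ) := by
  let _ : MeasurableSpace (Finset ℕ) := ⊤
  have hV : ∀ t, Measurable (V t) := fun t => by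
    refine measurable_to_countable' fun F => ?_
    have : V t ⁻¹' {F} = ⋂ i, {ω | i ∈ V t ω ↔ i ∈ F} := by
      ext ω
      simp [Finset.ext_iff]
    rw [this]
    refine MeasurableSet.iInter fun i => ?_
    by_cases hi : i ∈ F
    · simpa [hi] using hc.measurable t i
    · simp only [hi, iff_false]
      exact (hc.measurable t i).compl
  have hcard : ∀ t, Measurable fun ω => (V t ω \ V (t - 1) ω).card := fun t =>
    (measurable_from_prod_countable_left fun _ => measurable_from_top :
      Measurable fun q : Finset ℕ × Finset ℕ => (q.1 \ q.2).card).comp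
      ((hV t).prodMk (hV (t - 1)))
  unfold arrivals
  exact measurable_from_top.comp (Finset.measurable_sum _ fun t _ => hcard t)

lemma arrivals_le (ω : Ω) : (arrivals T (fun t => V t ω) : ℝ) ≤ 2 * T := by
  have h : arrivals T (fun t => V t ω) ≤ ∑ t ∈ Finset.Icc 2 T, 2 := by
    refine Finset.sum_le_sum fun t ht => ?_
    rw [Finset.mem_Icc] at ht
    exact (Finset.card_le_card Finset.sdiff_subset).trans
      (hc.card_le_two t (Finset.mem_Icc.2 ⟨by omega, ht.2⟩) ω)
  have h2 : arrivals T (fun t => V t ω) ≤ 2 * T := by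
    rw [Finset.sum_const, Nat.card_Icc, smul_eq_mul] at h
    omega
  exact_mod_cast h2

lemma integrable_arrivals [IsProbabilityMeasure μ] :
    Integrable (fun ω => (arrivals T (fun t => V t ω) : ℝ)) μ :=
  Integrable.of_bound hc.measurable_arrivals.aestronglyMeasurable (2 * T)
    (ae_of_all _ fun ω => by simpa using hc.arrivals_le ω)

end IsCandidateProcess

end Charge

/-! ### The expected regret of a trip -/

section Trip

variable {Ω : Type u} [mΩ : MeasurableSpace Ω] {μ : Measure Ω} [IsProbabilityMeasure μ] {σ β : ℝ}
  {G X : ℕ → ℕ → Ω → ℝ} {V : ℕ → Ω → Finset ℕ} {a : ℕ → Ω → Option ℕ} {T : ℕ}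

/-- A non-asymptotic bound on the expected average regret. -/
theorem IsMASSTrip.expectedAvgRegret_le (h : IsMASSTrip μ σ β T G X V a) (hσ : 0 < σ) (hβ : 0 < β)
    (hT : 0 < T) :
    expectedAvgRegret μ T G V a ≤ 2 * arrivalRate μ T V + 2 / T +
      2 * (32 * β ^ 2 * Real.log (1 + 1 / (4 * β)) +
        2 * (1 / β ^ 2 * (2 * Real.exp (-(β ^ 2 / (2 * σ ^ 2)))))) := by
  obtain ⟨hw, hc, -, hrun⟩ := h
  have hT' : (0 : ℝ) < T := by exact_mod_cast hT
  set κ : ℝ := 32 * β ^ 2 * Real.log (1 + 1 / (4 * β)) +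
    2 * (1 / β ^ 2 * (2 * Real.exp (-(β ^ 2 / (2 * σ ^ 2))))) with hκ
  have hκ0 : 0 ≤ κ := by
    have hlog : 0 ≤ Real.log (1 + 1 / (4 * β)) :=
      Real.log_nonneg (by have : 0 < 1 / (4 * β) := by positivity
                          linarith)
    positivity
  set c : ℕ → ℕ × ℕ → (ℕ → ℕ → ℝ) → ENNReal := fun t p g =>
    ENNReal.ofReal (pairCharge β t p g) with hcdef
  have hcm : ∀ t p, Measurable (c t p) := fun t p => (measurable_pairCharge hβ t p).ennreal_ofReal
  set Ψ : ℕ → Ω → ENNReal := fun t ω =>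
    ∑' p, {ω | p ∈ (V t ω).offDiag}.indicator 1 ω * c t p (fun i s => G i s ω) with hΨ
  have hΨm : ∀ t, Measurable (Ψ t) := fun t => Measurable.tsum fun p =>
    (measurable_one.indicator (hc.measurableSet_mem_offDiag t p)).mul
      ((hcm t p).comp hw.measurable_gains)
  have hΨle : ∀ t ∈ Finset.Icc 1 T, ∫⁻ ω, Ψ t ω ∂μ ≤ ENNReal.ofReal (2 * κ) := fun t ht => by
    rw [ENNReal.ofReal_mul zero_le_two, ENNReal.ofReal_ofNat]
    exact hc.lintegral_tsum_charge_le ht (hcm t) hw.measurable_gains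
      fun p hp => lintegral_pairCharge_le hw hσ hβ hp t
  have hΨtop : ∀ t ∈ Finset.Icc 1 T, ∫⁻ ω, Ψ t ω ∂μ ≠ ⊤ := fun t ht =>
    ne_top_of_le_ne_top ENNReal.ofReal_ne_top (hΨle t ht)
  have hΨi : ∀ t ∈ Finset.Icc 1 T, Integrable (fun ω => (Ψ t ω).toReal) μ := fun t ht =>
    integrable_toReal_of_lintegral_ne_top (hΨm t).aemeasurable (hΨtop t ht)
  have hΨint : ∀ t ∈ Finset.Icc 1 T, ∫ ω, (Ψ t ω).toReal ∂μ ≤ 2 * κ := fun t ht => by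
    rw [integral_toReal (hΨm t).aemeasurable (ae_lt_top (hΨm t) (hΨtop t ht))]
    exact ENNReal.toReal_le_of_le_ofReal (by positivity) (hΨle t ht)
  have hΨreal : ∀ t ω, (Ψ t ω).toReal =
      ∑ p ∈ (V t ω).offDiag, pairCharge β t p (fun i s => G i s ω) := fun t ω => by
    have h1 : Ψ t ω = ∑ p ∈ (V t ω).offDiag, c t p (fun i s => G i s ω) := by
      simp only [hΨ]
      rw [tsum_eq_sum (s := (V t ω).offDiag) fun p hp => by
        rw [Set.indicator_of_notMem (by exact hp), zero_mul]]
      exact Finset.sum_congr rfl fun p hp => by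
        rw [Set.indicator_of_mem (by exact hp), Pi.one_apply, one_mul]
    rw [h1, ENNReal.toReal_sum fun p _ => ENNReal.ofReal_ne_top]
    exact Finset.sum_congr rfl fun p _ => ENNReal.toReal_ofReal (pairCharge_nonneg hβ _ _ _)
  have hae : ∀ᵐ ω ∂μ, regret T (fun i t => G i t ω) (fun t => V t ω) (fun t => a t ω) ≤
      2 * (arrivals T (fun t => V t ω) : ℝ) + 2 + ∑ t ∈ Finset.Icc 1 T, (Ψ t ω).toReal := by
    filter_upwards [ae_all_iff.2 fun i => ae_all_iff.2 (hw.ae_gain_mem i)] with ω hω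
    simp only [hΨreal]
    exact regret_le hβ hω (fun t ht => hc.card_le_two t ht ω) (hrun ω)
  have harr := hc.integrable_arrivals
  have hi1 : Integrable (fun ω => 2 * (arrivals T (fun t => V t ω) : ℝ) + 2) μ :=
    (harr.const_mul 2).add (integrable_const 2)
  have hi2 : Integrable (fun ω => ∑ t ∈ Finset.Icc 1 T, (Ψ t ω).toReal) μ :=
    integrable_finsetSum _ hΨi
  -- Since the regret is nonnegative, only the upper bound has to be integrable. The bound holds
  -- almost surely because the gains lie in `[0, 1]` only almost surely.
  have hmain := integral_mono_of_nonneg (ae_of_all μ fun ω => regret_nonneg (hrun ω))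
    (hi1.add hi2) hae
  have hsum : ∫ ω, ∑ t ∈ Finset.Icc 1 T, (Ψ t ω).toReal ∂μ ≤ T * (2 * κ) := by
    rw [integral_finsetSum _ hΨi]
    calc _ ≤ ∑ t ∈ Finset.Icc 1 T, 2 * κ := Finset.sum_le_sum hΨint
      _ = _ := by simp
  simp only [Pi.add_apply] at hmain
  rw [integral_add hi1 hi2, integral_add (harr.const_mul 2) (integrable_const 2),
    integral_const_mul] at hmain
  simp only [integral_const, probReal_univ, one_smul] at hmain
  unfold expectedAvgRegret arrivalRate
  calc _ ≤ 1 / (T : ℝ) * (2 * ∫ ω, (arrivals T (fun t => V t ω) : ℝ) ∂μ + 2 + T * (2 * κ)) :=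
        mul_le_mul_of_nonneg_left (by linarith) (by positivity)
    _ = _ := by field_simp

end Trip

/-! ### Asymptotics for the chosen `β` -/

lemma slot_charge_le {σ : ℝ} (hσ : 0 < σ) (hσ1 : σ < Real.exp (-1)) :
    32 * (15 * σ * Real.log (1 / σ)) ^ 2 *
        Real.log (1 + 1 / (4 * (15 * σ * Real.log (1 / σ)))) +
      2 * (1 / (15 * σ * Real.log (1 / σ)) ^ 2 *
        (2 * Real.exp (-((15 * σ * Real.log (1 / σ)) ^ 2 / (2 * σ ^ 2))))) ≤
      14401 * (σ ^ 2 * Real.log (1 / σ) ^ 3) := by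
  set L := Real.log (1 / σ) with hL
  have hLσ : Real.log σ = -L := by rw [hL, one_div, Real.log_inv, neg_neg]
  have hL1 : 1 < L := by
    have := Real.log_lt_log hσ hσ1
    rw [Real.log_exp, hLσ] at this
    linarith
  have hσe : σ = Real.exp (-L) := by rw [← hLσ, Real.exp_log hσ]
  have hσ2 : σ ≤ 1 / 2 := by
    have h2 := Real.add_one_le_exp (1 : ℝ)
    rw [Real.exp_neg] at hσ1
    calc σ ≤ (Real.exp 1)⁻¹ := hσ1.le
      _ ≤ (2 : ℝ)⁻¹ := inv_anti₀ (by norm_num) (by linarith)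
      _ = 1 / 2 := by norm_num
  have hβσ : σ ≤ 4 * (15 * σ * L) := by nlinarith
  have hlog : Real.log (1 + 1 / (4 * (15 * σ * L))) ≤ 2 * L := by
    -- From `4β ≥ σ` the left side is at most `1 + 1/σ`, and `1/σ ≥ 2`.
    have h1 : 1 + 1 / (4 * (15 * σ * L)) ≤ (1 / σ) ^ 2 := by
      have h2 : 1 / (4 * (15 * σ * L)) ≤ 1 / σ := one_div_le_one_div_of_le hσ hβσ
      have h3 : 2 ≤ 1 / σ := by rw [le_div_iff₀ hσ]; linarith
      nlinarith
    have h0 : 0 < 1 + 1 / (4 * (15 * σ * L)) := by positivity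
    calc _ ≤ Real.log ((1 / σ) ^ 2) := Real.log_le_log h0 h1
      _ = 2 * L := by rw [Real.log_pow]; norm_num [hL]
  -- The exponent is `(225/2) L² ≥ 4L` because `L > 1`. A fourth power suffices: two of its factors
  -- absorb the `1/β²` from the union bound and `σ²` remains.
  have hexp : Real.exp (-((15 * σ * L) ^ 2 / (2 * σ ^ 2))) ≤ σ ^ 4 := by
    have h1 : (15 * σ * L) ^ 2 / (2 * σ ^ 2) = 225 / 2 * L ^ 2 := by field_simp; norm_num
    rw [h1]
    calc Real.exp (-(225 / 2 * L ^ 2)) ≤ Real.exp (4 * -L) := Real.exp_le_exp.2 (by nlinarith)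
      _ = σ ^ 4 := by
        conv_rhs => rw [hσe]
        rw [← Real.exp_nat_mul]
        norm_num
  have hL3 : 1 ≤ L ^ 3 := one_le_pow₀ hL1.le
  have hfirst : 32 * (15 * σ * L) ^ 2 * Real.log (1 + 1 / (4 * (15 * σ * L))) ≤
      14400 * (σ ^ 2 * L ^ 3) := by
    calc _ ≤ 32 * (15 * σ * L) ^ 2 * (2 * L) := by gcongr
      _ = _ := by ring
  have hsecond : 2 * (1 / (15 * σ * L) ^ 2 *
      (2 * Real.exp (-((15 * σ * L) ^ 2 / (2 * σ ^ 2))))) ≤ σ ^ 2 * L ^ 3 := by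
    have hb : σ ^ 2 ≤ (15 * σ * L) ^ 2 / 4 := by
      have : 15 * σ ≤ 15 * σ * L := by nlinarith
      nlinarith
    calc _ ≤ 2 * (1 / (15 * σ * L) ^ 2 * (2 * σ ^ 4)) := by gcongr
      _ = σ ^ 2 * (4 * σ ^ 2 / (15 * σ * L) ^ 2) := by ring
      _ ≤ σ ^ 2 * 1 := by
          gcongr
          rw [div_le_one (by positivity)]
          linarith
      _ ≤ _ := by gcongr
  linarith

/-- The start-up cost `2/T` is at most `2σ²/c` by the lower bound on `T`, and `28802 = 2 · 14401` is
twice the slot constant. -/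
theorem IsMASSTrip.expectedAvgRegret_le_arrivalRate {c σ : ℝ} (hc : 0 < c) (hσ : 0 < σ)
    (hσ1 : σ < Real.exp (-1)) {T : ℕ} (hT : c * (σ ^ 2)⁻¹ ≤ T) {Ω : Type u} [MeasurableSpace Ω]
    {μ : Measure Ω} [IsProbabilityMeasure μ] {G X : ℕ → ℕ → Ω → ℝ} {V : ℕ → Ω → Finset ℕ}
    {a : ℕ → Ω → Option ℕ} (h : IsMASSTrip μ σ (15 * σ * Real.log (1 / σ)) T G X V a) :
    expectedAvgRegret μ T G V a ≤
      (2 / c + 28802) * (σ ^ 2 * Real.log (1 / σ) ^ 3) + 2 * arrivalRate μ T V := by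
  have hL1 : 1 < Real.log (1 / σ) := by
    have := Real.log_lt_log hσ hσ1
    rw [Real.log_exp] at this
    rw [one_div, Real.log_inv]
    linarith
  have hcσ : 0 < c * (σ ^ 2)⁻¹ := by positivity
  have hT0 : (0 : ℝ) < T := hcσ.trans_le hT
  have hmain := h.expectedAvgRegret_le hσ (by positivity) (by exact_mod_cast hT0)
  have hslot := slot_charge_le hσ hσ1
  have hstart : 2 / (T : ℝ) ≤ 2 / c * (σ ^ 2 * Real.log (1 / σ) ^ 3) := by
    calc 2 / (T : ℝ) ≤ 2 / (c * (σ ^ 2)⁻¹) := by gcongr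
      _ = 2 / c * (σ ^ 2 * 1) := by field_simp
      _ ≤ _ := by
        gcongr
        exact one_le_pow₀ hL1.le
  linarith

end SensorScheduling

theorem theorem2 :
    (∀ c : ℝ, 0 < c → ∃ C σ₀ : ℝ, 0 < C ∧ 0 < σ₀ ∧ σ₀ < 1 ∧
      ∀ σ : ℝ, 0 < σ → σ < σ₀ → ∀ T : ℕ, c * (σ ^ 2)⁻¹ ≤ (T : ℝ) →
      ∀ (Ω : Type u) [MeasurableSpace Ω] (μ : Measure Ω) [IsProbabilityMeasure μ]
        (G X : ℕ → ℕ → Ω → ℝ) (V : ℕ → Ω → Finset ℕ) (a : ℕ → Ω → Option ℕ),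
        SensorScheduling.IsMASSTrip μ σ (15 * σ * Real.log (1 / σ)) T G X V a →
        SensorScheduling.expectedAvgRegret μ T G V a ≤
          C * (σ ^ 2 * Real.log (1 / σ) ^ 3) + 2 * SensorScheduling.arrivalRate μ T V) ∧
    (∀ c K : ℝ, 0 < c → 0 < K → ∃ C σ₀ : ℝ, 0 < C ∧ 0 < σ₀ ∧ σ₀ < 1 ∧
      ∀ σ : ℝ, 0 < σ → σ < σ₀ → ∀ T : ℕ, c * (σ ^ 2)⁻¹ ≤ (T : ℝ) →
      ∀ (Ω : Type u) [MeasurableSpace Ω] (μ : Measure Ω) [IsProbabilityMeasure μ]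
        (G X : ℕ → ℕ → Ω → ℝ) (V : ℕ → Ω → Finset ℕ) (a : ℕ → Ω → Option ℕ),
        SensorScheduling.IsMASSTrip μ σ (15 * σ * Real.log (1 / σ)) T G X V a →
        SensorScheduling.arrivalRate μ T V ≤ K * (σ ^ 2 * Real.log (1 / σ) ^ 3) →
        SensorScheduling.expectedAvgRegret μ T G V a ≤
          C * (σ ^ 2 * Real.log (1 / σ) ^ 3)) := by
  have hσ₀ : Real.exp (-1) < 1 := by
    simp
  refine ⟨fun c hc => ⟨2 / c + 28802, Real.exp (-1), by positivity, Real.exp_pos _, hσ₀, ?_⟩,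
    fun c K hc hK => ⟨2 / c + 28802 + 2 * K, Real.exp (-1), by positivity, Real.exp_pos _, hσ₀, ?_⟩⟩
  · intro σ hσ hσ1 T hT Ω _ μ _ G X V a h
    exact h.expectedAvgRegret_le_arrivalRate hc hσ hσ1 hT
  · intro σ hσ hσ1 T hT Ω _ μ _ G X V a h hrate
    have := h.expectedAvgRegret_le_arrivalRate hc hσ hσ1 hT
    linarith
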